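/- Let $n$ be a natural number, let $-\infty<\alpha<\beta<\infty$, and let $A$ be an invertible complex $n\times n$ matrix. Let $U,V$ be linear subspaces of $\mathbb{C}^n$ with $U\cap V=\{0\}$ and $U+V=\mathbb{C}^n$. Let $H$ be the operator in $L^2((\alpha,\beta),\mathbb{C}^n)$ given by $Hf=-Af''$ (weak second derivative), whose domain is the set of all $f\in W^{2,2}((\alpha,\beta),\mathbb{C}^n)$ such that $f(\alpha)\in U$, $f(\beta)\in U$, $f'(\alpha)\in V$ and $f'(\beta)\in V$, where the boundary values are those of the representatives of $f$ and $f'$ that are continuous on $[\alpha,\beta]$. If $A$ is accretive, that is, $\operatorname{Re}\langle Av,v\rangle\ge 0$ for all $v\in\mathbb{C}^n$, and $AV\perp U$, both with respect to the standard inner product of $\mathbb{C}^n$, then $-H$ is the infinitesimal generator of a strongly continuous one-parameter semigroup $(T_t)_{t\ge 0}$ of contractions ($\|T_t\|\le 1$) on $L^2((\alpha,\beta),\mathbb{C}^n)$. -/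

import Mathlib

open Set Filter Topology MeasureTheory
open scoped NNReal ContDiff

noncomputable section

namespace SecondOrderSystem

/-! ## Strongly continuous contraction semigroups and their generators -/

section Semigroup

variable {X : Type*} [NormedAddCommGroup X] [NormedSpace ℂ X]

/-- A strongly continuous one-parameter semigroup of contractions on `X`, indexed by `[0, ∞)`. -/
structure IsContractionSemigroup (T : ℝ≥0 → X →L[ℂ] X) : Prop where
  map_zero : T 0 = ContinuousLinearMap.id ℂ X
  map_add : ∀ s t : ℝ≥0, T (s + t) = (T s).comp (T t)
  continuous_orbit : ∀ f : X, Continuous fun t : ℝ≥0 => T t f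
  norm_le_one : ∀ t : ℝ≥0, ‖T t‖ ≤ 1

/-- The (possibly unbounded) operator `G` is the infinitesimal generator of the family `T`:
`f ∈ Dom(G)` and `G f = g` hold exactly when `t⁻¹ (T t f - f) → g` in norm as `t → 0+`. -/
def IsGenerator (G : X →ₗ.[ℂ] X) (T : ℝ≥0 → X →L[ℂ] X) : Prop :=
  ∀ f g : X, (f, g) ∈ G.graph ↔
    Tendsto (fun t : ℝ≥0 => ((t : ℝ)⁻¹ : ℂ) • (T t f - f)) (𝓝[>] 0) (𝓝 g)

/-- `G` generates a strongly continuous contraction semigroup. -/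
def GeneratesContractionSemigroup (G : X →ₗ.[ℂ] X) : Prop :=
  ∃ T : ℝ≥0 → X →L[ℂ] X, IsContractionSemigroup T ∧ IsGenerator G T

end Semigroup

/-- A complex square matrix is accretive if `Re ⟨A v, v⟩ ≥ 0` for all vectors `v`, with respect to
the standard inner product. -/
def IsAccretive {n : ℕ} (A : Matrix (Fin n) (Fin n) ℂ) : Prop :=
  ∀ v : EuclideanSpace ℂ (Fin n), 0 ≤ (inner ℂ v (Matrix.toEuclideanCLM (𝕜 := ℂ) A v)).re

/-! ## The space `L²((α, β), ℂⁿ)`, weak derivatives and boundary values -/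

/-- The Hilbert space `L²((α, β), ℂⁿ)`. -/
abbrev L2 (n : ℕ) (α β : ℝ) : Type :=
  Lp (EuclideanSpace ℂ (Fin n)) 2 (volume.restrict (Ioo α β))

variable {n : ℕ} {α β : ℝ}

/-- `g` is the weak derivative of `f` on `(α, β)`: `∫ φ' f = - ∫ φ g` for every smooth test
function `φ` with compact support contained in `(α, β)`. -/
def HasWeakDeriv (f g : L2 n α β) : Prop :=
  ∀ φ : ℝ → ℝ, ContDiff ℝ ∞ φ → HasCompactSupport φ → tsupport φ ⊆ Ioo α β →
    ∫ x in Ioo α β, deriv φ x • f x = - ∫ x in Ioo α β, φ x • g x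

/-- `f` has a representative that is continuous on `[α, β]` with values `a` at `α` and `b`
at `β`. -/
def HasBoundaryValues (f : L2 n α β) (a b : EuclideanSpace ℂ (Fin n)) : Prop :=
  ∃ u : ℝ → EuclideanSpace ℂ (Fin n), ContinuousOn u (Icc α β) ∧
    f =ᵐ[volume.restrict (Ioo α β)] u ∧ u α = a ∧ u β = b

lemma L2.integrable (f : L2 n α β) : Integrable f (volume.restrict (Ioo α β)) :=
  (Lp.memLp f).integrable (by norm_num)

lemma integrable_smul_L2 {φ : ℝ → ℝ} (hφ : Continuous φ) (hc : HasCompactSupport φ)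
    (f : L2 n α β) : Integrable (fun x => φ x • f x) (volume.restrict (Ioo α β)) := by
  obtain ⟨C, hC⟩ := hc.exists_bound_of_continuous hφ
  exact (L2.integrable f).bdd_smul C hφ.aestronglyMeasurable (ae_of_all _ hC)

lemma HasWeakDeriv.add {f g f' g' : L2 n α β} (hf : HasWeakDeriv f f') (hg : HasWeakDeriv g g') :
    HasWeakDeriv (f + g) (f' + g') := by
  intro φ h1 h2 h3
  have e1 : ∫ x in Ioo α β, deriv φ x • (f + g : L2 n α β) x
      = ∫ x in Ioo α β, (deriv φ x • f x + deriv φ x • g x) := by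
    refine integral_congr_ae ?_
    filter_upwards [Lp.coeFn_add f g] with x hx
    rw [hx, Pi.add_apply, smul_add]
  have e2 : ∫ x in Ioo α β, φ x • (f' + g' : L2 n α β) x
      = ∫ x in Ioo α β, (φ x • f' x + φ x • g' x) := by
    refine integral_congr_ae ?_
    filter_upwards [Lp.coeFn_add f' g'] with x hx
    rw [hx, Pi.add_apply, smul_add]
  have hd : Continuous (deriv φ) := h1.continuous_deriv (by simp)
  rw [e1, e2, integral_add (integrable_smul_L2 hd h2.deriv f) (integrable_smul_L2 hd h2.deriv g),
    integral_add (integrable_smul_L2 h1.continuous h2 f')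
      (integrable_smul_L2 h1.continuous h2 g'), hf φ h1 h2 h3, hg φ h1 h2 h3, neg_add]

lemma HasWeakDeriv.smul {f f' : L2 n α β} (c : ℂ) (hf : HasWeakDeriv f f') :
    HasWeakDeriv (c • f) (c • f') := by
  intro φ h1 h2 h3
  have e1 : ∫ x in Ioo α β, deriv φ x • (c • f : L2 n α β) x
      = ∫ x in Ioo α β, c • (deriv φ x • f x) := by
    refine integral_congr_ae ?_
    filter_upwards [Lp.coeFn_smul c f] with x hx
    rw [hx, Pi.smul_apply, smul_comm]
  have e2 : ∫ x in Ioo α β, φ x • (c • f' : L2 n α β) x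
      = ∫ x in Ioo α β, c • (φ x • f' x) := by
    refine integral_congr_ae ?_
    filter_upwards [Lp.coeFn_smul c f'] with x hx
    rw [hx, Pi.smul_apply, smul_comm]
  rw [e1, e2, integral_smul, integral_smul, hf φ h1 h2 h3, smul_neg]

lemma HasWeakDeriv.zero : HasWeakDeriv (0 : L2 n α β) 0 := by
  intro φ _ _ _
  have h0 : ∀ ψ : ℝ → ℝ, ∫ x in Ioo α β, ψ x • (0 : L2 n α β) x = 0 := by
    intro ψ
    refine integral_eq_zero_of_ae ?_
    filter_upwards [Lp.coeFn_zero (EuclideanSpace ℂ (Fin n)) 2 (volume.restrict (Ioo α β))]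
      with x hx
    exact (congrArg (fun y => ψ x • y) hx).trans (smul_zero _)
  rw [h0, h0, neg_zero]

/-- Weak derivatives are unique. -/
lemma HasWeakDeriv.unique {f g h : L2 n α β} (hg : HasWeakDeriv f g) (hh : HasWeakDeriv f h) :
    g = h := by
  have key := isOpen_Ioo.ae_eq_zero_of_integral_contDiff_smul_eq_zero
    (f := fun x => g x - h x) (μ := volume) (U := Ioo α β)
    (IntegrableOn.locallyIntegrableOn ((L2.integrable g).sub (L2.integrable h))) (by
      intro φ h1 h2 h3
      rw [← setIntegral_eq_integral_of_forall_compl_eq_zero (s := Ioo α β) (by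
        intro x hx
        rw [image_eq_zero_of_notMem_tsupport (fun h => hx (h3 h)), zero_smul])]
      simp only [smul_sub]
      rw [integral_sub (integrable_smul_L2 h1.continuous h2 g)
        (integrable_smul_L2 h1.continuous h2 h), sub_eq_zero]
      have := (hg φ h1 h2 h3).symm.trans (hh φ h1 h2 h3)
      exact neg_injective this)
  refine Lp.ext ((ae_restrict_iff' measurableSet_Ioo).2 ?_)
  filter_upwards [key] with x hx hx'
  exact sub_eq_zero.1 (hx hx')

lemma HasBoundaryValues.add {f g : L2 n α β} {a b c d : EuclideanSpace ℂ (Fin n)}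
    (hf : HasBoundaryValues f a b) (hg : HasBoundaryValues g c d) :
    HasBoundaryValues (f + g) (a + c) (b + d) := by
  obtain ⟨u, hu, hfu, rfl, rfl⟩ := hf
  obtain ⟨v, hv, hgv, rfl, rfl⟩ := hg
  refine ⟨u + v, hu.add hv, ?_, rfl, rfl⟩
  filter_upwards [Lp.coeFn_add f g, hfu, hgv] with x h1 h2 h3
  rw [h1, Pi.add_apply, Pi.add_apply, h2, h3]

lemma HasBoundaryValues.smul {f : L2 n α β} {a b : EuclideanSpace ℂ (Fin n)} (c : ℂ)
    (hf : HasBoundaryValues f a b) : HasBoundaryValues (c • f) (c • a) (c • b) := by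
  obtain ⟨u, hu, hfu, rfl, rfl⟩ := hf
  refine ⟨c • u, hu.const_smul c, ?_, rfl, rfl⟩
  filter_upwards [Lp.coeFn_smul c f, hfu] with x h1 h2
  rw [h1, Pi.smul_apply, Pi.smul_apply, h2]

lemma HasBoundaryValues.zero : HasBoundaryValues (0 : L2 n α β) 0 0 :=
  ⟨0, continuousOn_const, Lp.coeFn_zero _ _ _, rfl, rfl⟩

/-! ## The operator `H f = -A f''` -/

/-- The set of `f ∈ W^{2,2}((α, β), ℂⁿ)` such that `f(α), f(β) ∈ U` and `f'(α), f'(β) ∈ V`. -/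
def bvpDomain (n : ℕ) (α β : ℝ) (U V : Submodule ℂ (EuclideanSpace ℂ (Fin n))) :
    Submodule ℂ (L2 n α β) where
  carrier := {f | ∃ f₁ f₂ : L2 n α β, HasWeakDeriv f f₁ ∧ HasWeakDeriv f₁ f₂ ∧
    (∃ a ∈ U, ∃ b ∈ U, HasBoundaryValues f a b) ∧
    (∃ a ∈ V, ∃ b ∈ V, HasBoundaryValues f₁ a b)}
  zero_mem' := ⟨0, 0, .zero, .zero, ⟨0, U.zero_mem, 0, U.zero_mem, .zero⟩,
    ⟨0, V.zero_mem, 0, V.zero_mem, .zero⟩⟩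
  add_mem' := by
    rintro f g ⟨f₁, f₂, h1, h2, ⟨a, ha, b, hb, h3⟩, ⟨c, hc, d, hd, h4⟩⟩
      ⟨g₁, g₂, k1, k2, ⟨a', ha', b', hb', k3⟩, ⟨c', hc', d', hd', k4⟩⟩
    exact ⟨f₁ + g₁, f₂ + g₂, h1.add k1, h2.add k2,
      ⟨_, U.add_mem ha ha', _, U.add_mem hb hb', h3.add k3⟩,
      ⟨_, V.add_mem hc hc', _, V.add_mem hd hd', h4.add k4⟩⟩
  smul_mem' := by
    rintro z f ⟨f₁, f₂, h1, h2, ⟨a, ha, b, hb, h3⟩, ⟨c, hc, d, hd, h4⟩⟩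
    exact ⟨z • f₁, z • f₂, h1.smul z, h2.smul z,
      ⟨_, U.smul_mem z ha, _, U.smul_mem z hb, h3.smul z⟩,
      ⟨_, V.smul_mem z hc, _, V.smul_mem z hd, h4.smul z⟩⟩

/-- `g = f''` in the weak sense. -/
def HasWeakSecondDeriv (f g : L2 n α β) : Prop :=
  ∃ f₁ : L2 n α β, HasWeakDeriv f f₁ ∧ HasWeakDeriv f₁ g

lemma HasWeakSecondDeriv.unique {f g h : L2 n α β} (hg : HasWeakSecondDeriv f g)
    (hh : HasWeakSecondDeriv f h) : g = h := by
  obtain ⟨f₁, h1, h2⟩ := hg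
  obtain ⟨f₂, k1, k2⟩ := hh
  obtain rfl := h1.unique k1
  exact h2.unique k2

lemma exists_hasWeakSecondDeriv {U V : Submodule ℂ (EuclideanSpace ℂ (Fin n))}
    (f : bvpDomain n α β U V) : ∃ g : L2 n α β, HasWeakSecondDeriv (f : L2 n α β) g := by
  obtain ⟨f₁, f₂, h1, h2, -, -⟩ := f.2
  exact ⟨f₂, f₁, h1, h2⟩

/-- The map `f ↦ f''` on the domain determined by the boundary conditions. -/
def secondDeriv (n : ℕ) (α β : ℝ) (U V : Submodule ℂ (EuclideanSpace ℂ (Fin n))) :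
    bvpDomain n α β U V →ₗ[ℂ] L2 n α β where
  toFun f := (exists_hasWeakSecondDeriv f).choose
  map_add' f g := by
    obtain ⟨f₁, h1, h2⟩ := (exists_hasWeakSecondDeriv f).choose_spec
    obtain ⟨g₁, k1, k2⟩ := (exists_hasWeakSecondDeriv g).choose_spec
    exact (exists_hasWeakSecondDeriv (f + g)).choose_spec.unique
      ⟨f₁ + g₁, h1.add k1, h2.add k2⟩
  map_smul' c f := by
    obtain ⟨f₁, h1, h2⟩ := (exists_hasWeakSecondDeriv f).choose_spec
    exact (exists_hasWeakSecondDeriv (c • f)).choose_spec.unique ⟨c • f₁, h1.smul c, h2.smul c⟩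

lemma secondDeriv_spec {U V : Submodule ℂ (EuclideanSpace ℂ (Fin n))}
    (f : bvpDomain n α β U V) :
    HasWeakSecondDeriv (f : L2 n α β) (secondDeriv n α β U V f) :=
  (exists_hasWeakSecondDeriv f).choose_spec

/-- The operator `H f = -A f''` in `L²((α, β), ℂⁿ)`, with domain all `f ∈ W^{2,2}` satisfying
`f(α), f(β) ∈ U` and `f'(α), f'(β) ∈ V`. The matrix `A` acts pointwise. -/
def operatorH (α β : ℝ) {n : ℕ} (A : Matrix (Fin n) (Fin n) ℂ)
    (U V : Submodule ℂ (EuclideanSpace ℂ (Fin n))) : L2 n α β →ₗ.[ℂ] L2 n α β where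
  domain := bvpDomain n α β U V
  toFun := -(((Matrix.toEuclideanCLM (𝕜 := ℂ) A).compLpL 2
    (volume.restrict (Ioo α β))).toLinearMap ∘ₗ secondDeriv n α β U V)

end SecondOrderSystem

end

open Set Filter Topology MeasureTheory
open scoped NNReal ContDiff

noncomputable section

namespace SecondOrderSystem

/-! ## Uniformly continuous contraction semigroups -/

section Exponential

/-! By the Lumer–Phillips theorem it suffices that `-H` is dissipative and that `r + H` is onto for
a single `r > 0`.

Dissipativity is one integration by parts: `⟨f, A f''⟩ = [⟨f, A f'⟩] - ⟨f', A f'⟩`. The boundary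
terms vanish because `f ∈ U`, `f' ∈ V` at both endpoints and `AV ⊥ U`; accretivity of `A` gives the
sign of the remaining term (`re_inner_neg_operatorH_nonpos`).

Surjectivity is a shooting argument. For small `r` the equation `r f - A f'' = g` has a solution
with prescribed initial data `(a, c) ∈ U × V`, linear in the data
(`exists_initialValueProblem_solution`). The conditions at `β` form a linear system from `U × V` to
`E/U × E/V`, where `E = ℂⁿ`. These spaces have equal dimension since `U` and `V` are complementary,
and the system is injective by dissipativity, hence solvable (`exists_linearMap_add_mem`). Sobolev
functions are handled throughout as constant plus primitive
(`hasWeakDeriv_and_hasBoundaryValues_iff`).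

Lumer–Phillips itself is proved in Hilbert space, where density of the domain is automatic, by
exponentiating Yosida approximations and passing to the limit. -/

lemma re_inner_self_eq {X : Type*} [NormedAddCommGroup X] [InnerProductSpace ℂ X] (x : X) :
    (inner ℂ x x).re = ‖x‖ ^ 2 := by
  simpa using (norm_sq_eq_re_inner (𝕜 := ℂ) x).symm

variable {X : Type*} [NormedAddCommGroup X] [InnerProductSpace ℂ X] [CompleteSpace X]

lemma hasDerivAt_exp_smul_apply (B : X →L[ℂ] X) (x : X) (t : ℝ) :
    HasDerivAt (fun t : ℝ => (NormedSpace.exp (t • B) : X →L[ℂ] X) x)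
      ((NormedSpace.exp (t • B) : X →L[ℂ] X) (B x)) t :=
  ((ContinuousLinearMap.apply ℂ X x).restrictScalars ℝ).hasFDerivAt.comp_hasDerivAt t
    (hasDerivAt_exp_smul_const (𝕂 := ℝ) B t)

lemma exp_smul_apply_comm (B : X →L[ℂ] X) (x : X) (t : ℝ) :
    (NormedSpace.exp (t • B) : X →L[ℂ] X) (B x) = B ((NormedSpace.exp (t • B) : X →L[ℂ] X) x) :=
  congrArg (fun S : X →L[ℂ] X => S x)
    (((Commute.refl B).smul_left t).exp_left : Commute (NormedSpace.exp (t • B)) B).eq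

/-- The semigroup generated by a bounded dissipative operator is contractive. -/
lemma norm_exp_smul_apply_le {B : X →L[ℂ] X} (hB : ∀ x, (inner ℂ x (B x)).re ≤ 0) (x : X)
    {t : ℝ} (ht : 0 ≤ t) : ‖(NormedSpace.exp (t • B) : X →L[ℂ] X) x‖ ≤ ‖x‖ := by
  set u : ℝ → X := fun t => (NormedSpace.exp (t • B) : X →L[ℂ] X) x with hu
  have hd : ∀ s, HasDerivAt (fun s => (inner ℂ (u s) (u s)).re)
      (2 * (inner ℂ (u s) (B (u s))).re) s := by
    intro s
    have h1 : HasDerivAt u (B (u s)) s := by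
      have := hasDerivAt_exp_smul_apply B x s
      rwa [exp_smul_apply_comm] at this
    have h2 := Complex.reCLM.hasFDerivAt.comp_hasDerivAt s (h1.inner ℂ h1)
    convert! h2 using 1
    have : (inner ℂ (B (u s)) (u s)).re = (inner ℂ (u s) (B (u s))).re :=
      inner_re_symm (𝕜 := ℂ) _ _
    simp only [Complex.reCLM_apply, Complex.add_re, this]
    ring
  have hanti := antitone_of_hasDerivAt_nonpos hd (fun s => by
    have := hB (u s)
    simp only [Pi.zero_apply]
    linarith)
  have h0 := hanti ht
  simp only [re_inner_self_eq] at h0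
  have hu0 : u 0 = x := by simp [hu, NormedSpace.exp_zero]
  rw [hu0] at h0
  exact (pow_le_pow_iff_left₀ (norm_nonneg _) (norm_nonneg _) two_ne_zero).1 h0

/-- The path `s ↦ exp((t - s)C) exp(sB) x` joins the two vectors. By commutation its derivative is
`exp((t - s)C) exp(sB) (Bx - Cx)`, and both exponentials are contractions. This makes the
approximating semigroups Cauchy as soon as their generators converge pointwise. -/
lemma norm_exp_smul_sub_exp_smul_le {B C : X →L[ℂ] X} (hB : ∀ x, (inner ℂ x (B x)).re ≤ 0)
    (hC : ∀ x, (inner ℂ x (C x)).re ≤ 0) (hBC : Commute B C) (x : X) {t : ℝ} (ht : 0 ≤ t) :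
    ‖(NormedSpace.exp (t • B) : X →L[ℂ] X) x - (NormedSpace.exp (t • C) : X →L[ℂ] X) x‖
      ≤ t * ‖B x - C x‖ := by
  set F : ℝ → X := fun s => ((NormedSpace.exp ((t - s) • C) : X →L[ℂ] X) *
    (NormedSpace.exp (s • B) : X →L[ℂ] X)) x with hF
  have hd : ∀ s, HasDerivAt F ((NormedSpace.exp ((t - s) • C) : X →L[ℂ] X)
      ((NormedSpace.exp (s • B) : X →L[ℂ] X) (B x - C x))) s := by
    intro s
    have h1 : HasDerivAt (fun s : ℝ => (NormedSpace.exp ((t - s) • C) : X →L[ℂ] X))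
        (-(NormedSpace.exp ((t - s) • C) * C)) s := by
      have := (hasDerivAt_exp_smul_const (𝕂 := ℝ) C (t - s)).scomp s
        ((hasDerivAt_id s).const_sub t)
      simpa [Function.comp_def] using this
    have h2 := h1.mul (hasDerivAt_exp_smul_const (𝕂 := ℝ) B s)
    have h3 := ((ContinuousLinearMap.apply ℂ X x).restrictScalars ℝ).hasFDerivAt.comp_hasDerivAt s h2
    convert! h3 using 1
    have hc : C * (NormedSpace.exp (s • B) : X →L[ℂ] X) = NormedSpace.exp (s • B) * C :=
      ((hBC.symm.smul_right s).exp_right).eq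
    have : -(NormedSpace.exp ((t - s) • C) * C) * (NormedSpace.exp (s • B) : X →L[ℂ] X) +
        NormedSpace.exp ((t - s) • C) * (NormedSpace.exp (s • B) * B) =
        NormedSpace.exp ((t - s) • C) * (NormedSpace.exp (s • B) * (B - C)) := by
      rw [neg_mul, mul_assoc, hc]
      noncomm_ring
    rw [this]
    rfl
  have key := norm_image_sub_le_of_norm_deriv_le_segment' (f := F) (a := 0) (b := t)
    (C := ‖B x - C x‖) (fun s _ => (hd s).hasDerivWithinAt) (fun s hs =>
      (norm_exp_smul_apply_le hC _ (sub_nonneg.2 hs.2.le)).trans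
        (norm_exp_smul_apply_le hB _ hs.1)) t (right_mem_Icc.2 ht)
  simp only [hF, sub_self, zero_smul, NormedSpace.exp_zero, one_mul, sub_zero, mul_one] at key
  rwa [mul_comm] at key

lemma norm_exp_smul_sub_self_le {B : X →L[ℂ] X} (hB : ∀ x, (inner ℂ x (B x)).re ≤ 0) (x : X)
    {t : ℝ} (ht : 0 ≤ t) : ‖(NormedSpace.exp (t • B) : X →L[ℂ] X) x - x‖ ≤ t * ‖B x‖ := by
  simpa [NormedSpace.exp_zero] using
    norm_exp_smul_sub_exp_smul_le hB (C := 0) (by simp) (Commute.zero_right B) x ht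

/-- Mean value inequality for `s ↦ exp(sB) x - s y`. The bound involves `B` only through `ε`, so it
survives a limit over generators and controls the difference quotients of the limit semigroup. -/
lemma norm_exp_smul_sub_self_sub_le {B : X →L[ℂ] X} (x y : X) {t ε : ℝ} (ht : 0 ≤ t)
    (h : ∀ s ∈ Ico 0 t, ‖(NormedSpace.exp (s • B) : X →L[ℂ] X) (B x) - y‖ ≤ ε) :
    ‖(NormedSpace.exp (t • B) : X →L[ℂ] X) x - x - t • y‖ ≤ ε * t := by
  have key := norm_image_sub_le_of_norm_deriv_le_segment' (a := 0) (b := t) (C := ε)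
    (f := fun s : ℝ => (NormedSpace.exp (s • B) : X →L[ℂ] X) x - s • y)
    (f' := fun s : ℝ => (NormedSpace.exp (s • B) : X →L[ℂ] X) (B x) - y)
    (fun s _ => ((hasDerivAt_exp_smul_apply B x s).sub
      (by simpa using (hasDerivAt_id s).smul_const y)).hasDerivWithinAt) h t (right_mem_Icc.2 ht)
  simp only [zero_smul, NormedSpace.exp_zero, sub_zero, one_apply_eq_self] at key
  rwa [sub_right_comm] at key

lemma exp_add_smul_apply (B : X →L[ℂ] X) (s t : ℝ) (x : X) :
    (NormedSpace.exp ((s + t) • B) : X →L[ℂ] X) x =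
      (NormedSpace.exp (s • B) : X →L[ℂ] X) ((NormedSpace.exp (t • B) : X →L[ℂ] X) x) := by
  let _ : NormedAlgebra ℚ (X →L[ℂ] X) := NormedAlgebra.restrictScalars ℚ ℝ _
  rw [add_smul, NormedSpace.exp_add_of_commute (((Commute.refl B).smul_left s).smul_right t)]
  rfl

end Exponential

/-! ## Resolvents of dissipative operators -/

section Resolvent

variable {X : Type*} [NormedAddCommGroup X] [InnerProductSpace ℂ X]

/-- `R` is the inverse of `c - L`. -/
structure IsResolvent (L : X →ₗ.[ℂ] X) (c : ℝ) (R : X →L[ℂ] X) : Prop where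
  mem : ∀ g, R g ∈ L.domain
  sub_apply : ∀ g, (c : ℂ) • R g - L ⟨R g, mem g⟩ = g
  apply_sub : ∀ x : L.domain, R ((c : ℂ) • (x : X) - L x) = x

/-- Pair `c x - L x` with `x`: dissipativity discards `-Re ⟨x, L x⟩ ≥ 0`, and Cauchy–Schwarz does
the rest. For `c > 0` this gives injectivity of `c - L` and the bound `c⁻¹` for its inverse. -/
lemma norm_le_norm_smul_sub {L : X →ₗ.[ℂ] X}
    (hL : ∀ x : L.domain, (inner ℂ (x : X) (L x)).re ≤ 0) {c : ℝ} (x : L.domain) :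
    c * ‖(x : X)‖ ≤ ‖(c : ℂ) • (x : X) - L x‖ := by
  rcases eq_or_ne (x : X) 0 with hx | hx
  · simp [hx]
  have h1 : c * ‖(x : X)‖ ^ 2 ≤ (inner ℂ (x : X) ((c : ℂ) • (x : X) - L x)).re := by
    rw [inner_sub_right, inner_smul_right, Complex.sub_re, Complex.re_ofReal_mul,
      re_inner_self_eq]
    linarith [hL x]
  have h2 : (inner ℂ (x : X) ((c : ℂ) • (x : X) - L x)).re
      ≤ ‖(x : X)‖ * ‖(c : ℂ) • (x : X) - L x‖ :=
    (Complex.re_le_norm _).trans (norm_inner_le_norm _ _)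
  have h3 := norm_pos_iff.2 hx
  nlinarith

lemma exists_isResolvent {L : X →ₗ.[ℂ] X}
    (hL : ∀ x : L.domain, (inner ℂ (x : X) (L x)).re ≤ 0) {c : ℝ} (hc : 0 < c)
    (hs : ∀ g, ∃ x : L.domain, (c : ℂ) • (x : X) - L x = g) :
    ∃ R : X →L[ℂ] X, IsResolvent L c R := by
  let S : L.domain →ₗ[ℂ] X := (c : ℂ) • L.domain.subtype - L.toFun
  have hS : ∀ x, S x = (c : ℂ) • (x : X) - L x := fun x => rfl
  have hbd : ∀ x, c * ‖x‖ ≤ ‖S x‖ := fun x => norm_le_norm_smul_sub hL x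
  have hinj : Function.Injective S := by
    refine (injective_iff_map_eq_zero S).2 fun x hx => ?_
    have := hbd x
    rw [hx, norm_zero] at this
    exact norm_le_zero_iff.1 (by nlinarith [norm_nonneg x])
  let e := LinearEquiv.ofBijective S ⟨hinj, hs⟩
  have he : ∀ g, S (e.symm g) = g := fun g => e.apply_symm_apply g
  refine ⟨(L.domain.subtype ∘ₗ e.symm.toLinearMap).mkContinuous c⁻¹ fun g => ?_, ?_⟩
  · have := hbd (e.symm g)
    rw [he] at this
    rw [inv_mul_eq_div, le_div_iff₀ hc, mul_comm]
    exact this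
  · refine ⟨fun g => (e.symm g).2, fun g => he g, fun x => ?_⟩
    exact congrArg Subtype.val (e.symm_apply_apply x)

variable {L : X →ₗ.[ℂ] X} {c d : ℝ} {R S : X →L[ℂ] X}

lemma IsResolvent.norm_apply_le (hR : IsResolvent L c R)
    (hL : ∀ x : L.domain, (inner ℂ (x : X) (L x)).re ≤ 0) (g : X) : c * ‖R g‖ ≤ ‖g‖ := by
  simpa only [hR.sub_apply] using norm_le_norm_smul_sub hL ⟨R g, hR.mem g⟩ (c := c)

/-- The resolvent identity. -/
lemma IsResolvent.sub_eq (hR : IsResolvent L c R) (hS : IsResolvent L d S) (g : X) :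
    R g - S g = ((d - c : ℝ) : ℂ) • R (S g) := by
  -- Write `g = (d - L) S g = (c - L) S g + (d - c) S g` and apply `R`.
  have h1 : g = ((c : ℂ) • S g - L ⟨S g, hS.mem g⟩) + ((d - c : ℝ) : ℂ) • S g := by
    conv_lhs => rw [← hS.sub_apply g]
    push_cast
    module
  have h2 := hR.apply_sub ⟨S g, hS.mem g⟩
  conv_lhs => rw [h1, map_add, h2, map_smul]
  rw [← h1]
  simp

lemma IsResolvent.commute (hR : IsResolvent L c R) (hS : IsResolvent L d S) : Commute R S := by
  ext g
  change R (S g) = S (R g)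
  rcases eq_or_ne c d with rfl | h
  · have : R = S := by
      ext g
      have := hR.sub_eq hS g
      simpa [sub_eq_zero] using this
    rw [this]
  · have h1 := hR.sub_eq hS g
    have h2 := hS.sub_eq hR g
    have h3 : ((d - c : ℝ) : ℂ) • R (S g) = ((d - c : ℝ) : ℂ) • S (R g) := by
      rw [← h1, ← neg_sub, h2, ← neg_smul]
      push_cast
      module
    exact smul_right_injective X (Complex.ofReal_ne_zero.2 (sub_ne_zero.2 h.symm)) h3

/-- Factor `d - L = (1 - (c - d) R)(c - L)`. Since `‖R‖ ≤ c⁻¹`, the first factor is invertible by a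
Neumann series. -/
lemma IsResolvent.exists_of_abs_sub_lt [CompleteSpace X] (hR : IsResolvent L c R)
    (hL : ∀ x : L.domain, (inner ℂ (x : X) (L x)).re ≤ 0) (hc : 0 < c) (hd : |c - d| < c) (g : X) :
    ∃ x : L.domain, (d : ℂ) • (x : X) - L x = g := by
  have hRn : ‖R‖ ≤ c⁻¹ := R.opNorm_le_bound (inv_nonneg.2 hc.le) fun g => by
    rw [inv_mul_eq_div, le_div_iff₀ hc, mul_comm]
    exact hR.norm_apply_le hL g
  have hlt : ‖((c - d : ℝ) : ℂ) • R‖ < 1 := by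
    rw [norm_smul, Complex.norm_real, Real.norm_eq_abs]
    calc |c - d| * ‖R‖ ≤ |c - d| * c⁻¹ := by gcongr
      _ < c * c⁻¹ := by gcongr
      _ = 1 := mul_inv_cancel₀ hc.ne'
  obtain ⟨u, hu⟩ := isUnit_one_sub_of_norm_lt_one hlt
  set y : X := (↑u⁻¹ : X →L[ℂ] X) g with hy
  have h1 : y - ((c - d : ℝ) : ℂ) • R y = g := by
    have : ((u : X →L[ℂ] X) * (↑u⁻¹ : X →L[ℂ] X)) g = g := by rw [Units.mul_inv]; rfl
    rw [hu] at this
    exact this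
  refine ⟨⟨R y, hR.mem y⟩, ?_⟩
  have h2 := hR.sub_apply y
  rw [sub_eq_iff_eq_add] at h2
  rw [← h1, sub_eq_iff_eq_add]
  conv_rhs => enter [1, 1]; rw [← hR.sub_apply y]
  push_cast
  module

/-- Surjectivity of `c - L` for one `c > 0` yields the resolvents for all `c > 0`. -/
lemma exists_isResolvent_of_surjective [CompleteSpace X]
    (hL : ∀ x : L.domain, (inner ℂ (x : X) (L x)).re ≤ 0) (hc : 0 < c)
    (hs : ∀ g, ∃ x : L.domain, (c : ℂ) • (x : X) - L x = g) (hd : 0 < d) :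
    ∃ R : X →L[ℂ] X, IsResolvent L d R := by
  -- A resolvent at `c` reaches every point of `(0, 2c)`. Multiplying repeatedly by `3/2 < 2` moves
  -- `c` beyond `d`, and one last step down lands on `d`.
  have hstep : ∀ k : ℕ, ∃ R : X →L[ℂ] X, IsResolvent L ((3 / 2) ^ k * c) R := by
    intro k
    induction k with
    | zero => simpa using exists_isResolvent hL hc hs
    | succ k ih =>
      obtain ⟨R, hR⟩ := ih
      have hk : 0 < (3 / 2 : ℝ) ^ k * c := by positivity
      refine exists_isResolvent hL (by positivity) fun g =>
        hR.exists_of_abs_sub_lt hL hk ?_ g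
      rw [pow_succ, abs_lt]
      constructor <;> nlinarith
  obtain ⟨k, hk⟩ := pow_unbounded_of_one_lt (d / c) (by norm_num : (1 : ℝ) < 3 / 2)
  rw [div_lt_iff₀ hc] at hk
  obtain ⟨R, hR⟩ := hstep k
  refine exists_isResolvent hL hd fun g => hR.exists_of_abs_sub_lt hL (hd.trans hk) ?_ g
  rw [abs_lt]
  constructor <;> linarith

/-- In a Hilbert space the domain of a maximal dissipative operator is dense. -/
lemma IsResolvent.dense_domain [CompleteSpace X] (hR : IsResolvent L c R) (hc : 0 < c)
    (hL : ∀ x : L.domain, (inner ℂ (x : X) (L x)).re ≤ 0) : Dense (L.domain : Set X) := by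
  rw [Submodule.dense_iff_topologicalClosure_eq_top, Submodule.topologicalClosure_eq_top_iff,
    Submodule.eq_bot_iff]
  intro g hg
  -- Test `g ⊥ Dom(L)` against `R g`: then `0 = Re ⟨R g, (c - L) R g⟩ ≥ c ‖R g‖²`, so `R g = 0` and
  -- `g = (c - L) R g = 0`.
  have h1 : inner ℂ (R g) g = 0 := (Submodule.mem_orthogonal _ _).1 hg _ (hR.mem g)
  have h2 : c * ‖R g‖ ^ 2 ≤ (inner ℂ (R g) g).re := by
    conv_rhs => enter [1, 3]; rw [← hR.sub_apply g]
    rw [inner_sub_right, inner_smul_right, Complex.sub_re, Complex.re_ofReal_mul,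
      re_inner_self_eq]
    linarith [hL ⟨R g, hR.mem g⟩]
  rw [h1, Complex.zero_re] at h2
  have h3 : R g = 0 := by
    by_contra h
    have := norm_pos_iff.2 h
    have : 0 < c * ‖R g‖ ^ 2 := by positivity
    linarith
  have h4 : (⟨R g, hR.mem g⟩ : L.domain) = 0 := Subtype.ext h3
  rw [← hR.sub_apply g, h4, h3, smul_zero, LinearPMap.map_zero, sub_zero]

/-! ### Yosida approximation -/

lemma IsResolvent.apply_map (hR : IsResolvent L c R) (x : L.domain) :
    R (L x) = (c : ℂ) • R x - x := by
  have h := hR.apply_sub x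
  rw [map_sub, map_smul] at h
  exact eq_sub_of_add_eq' (sub_eq_iff_eq_add.1 h).symm

/-- The Yosida approximation `c L (c - L)⁻¹` in terms of the resolvent `R = (c - L)⁻¹`. -/
def yosida (c : ℝ) (R : X →L[ℂ] X) : X →L[ℂ] X := ((c ^ 2 : ℝ) : ℂ) • R - (c : ℂ) • 1

lemma yosida_apply (c : ℝ) (R : X →L[ℂ] X) (x : X) :
    yosida c R x = ((c ^ 2 : ℝ) : ℂ) • R x - (c : ℂ) • x := rfl

lemma IsResolvent.yosida_apply_mem (hR : IsResolvent L c R) (x : L.domain) :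
    yosida c R x = (c : ℂ) • R (L x) := by
  rw [hR.apply_map, yosida_apply, smul_sub, smul_smul]
  push_cast
  rw [sq]

lemma IsResolvent.re_inner_yosida_nonpos (hR : IsResolvent L c R) (hc : 0 < c)
    (hL : ∀ x : L.domain, (inner ℂ (x : X) (L x)).re ≤ 0) (x : X) :
    (inner ℂ x (yosida c R x)).re ≤ 0 := by
  rw [yosida_apply, inner_sub_right, inner_smul_right, inner_smul_right, Complex.sub_re,
    Complex.re_ofReal_mul, Complex.re_ofReal_mul, re_inner_self_eq]
  have h1 : (inner ℂ x (R x)).re ≤ ‖x‖ * ‖R x‖ :=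
    (Complex.re_le_norm _).trans (norm_inner_le_norm _ _)
  have h2 := hR.norm_apply_le hL x
  calc c ^ 2 * (inner ℂ x (R x)).re - c * ‖x‖ ^ 2
      ≤ c ^ 2 * (‖x‖ * ‖R x‖) - c * ‖x‖ ^ 2 := by gcongr
    _ = c * ‖x‖ * (c * ‖R x‖ - ‖x‖) := by ring
    _ ≤ 0 := mul_nonpos_of_nonneg_of_nonpos (by positivity) (by linarith)

lemma IsResolvent.commute_yosida (hR : IsResolvent L c R) (hS : IsResolvent L d S) :
    Commute (yosida c R) (yosida d S) := by
  unfold yosida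
  exact ((((hR.commute hS).smul_left _).smul_right _).sub_left
    (((Commute.one_left _).smul_left _).smul_right _)).sub_right
    ((((Commute.one_right _).smul_left _).smul_right _).sub_left
      (((Commute.one_right _).smul_left _).smul_right _))

/-- On the domain `c R x - x = R (L x)`, so `c R` tends to the identity there at rate `c⁻¹`. -/
lemma IsResolvent.norm_smul_apply_sub_le (hR : IsResolvent L c R) (hc : 0 < c)
    (hL : ∀ x : L.domain, (inner ℂ (x : X) (L x)).re ≤ 0) (x : L.domain) :
    ‖(c : ℂ) • R x - x‖ ≤ c⁻¹ * ‖L x‖ := by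
  rw [← hR.apply_map, inv_mul_eq_div, le_div_iff₀ hc, mul_comm]
  exact hR.norm_apply_le hL _

/-- A sequence of contractions that is pointwise Cauchy on a dense set is pointwise Cauchy. -/
lemma cauchySeq_of_dense {D : Set X} (hD : Dense D) {S : ℕ → X →L[ℂ] X}
    (hS : ∀ k x, ‖S k x‖ ≤ ‖x‖) (h : ∀ x ∈ D, CauchySeq fun k => S k x) (x : X) :
    CauchySeq fun k => S k x := by
  rw [Metric.cauchySeq_iff]
  intro ε hε
  obtain ⟨y, hy, hxy⟩ := Metric.mem_closure_iff.1 (hD x) (ε / 3) (by positivity)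
  obtain ⟨N, hN⟩ := Metric.cauchySeq_iff.1 (h y hy) (ε / 3) (by positivity)
  refine ⟨N, fun m hm k hk => ?_⟩
  have h1 : ∀ j, dist (S j x) (S j y) ≤ dist x y := fun j => by
    rw [dist_eq_norm, dist_eq_norm, ← map_sub]
    exact hS j _
  have := dist_triangle4 (S m x) (S m y) (S k y) (S k x)
  have h2 := h1 m
  have h3 := h1 k
  rw [dist_comm (S k x)] at h3
  linarith [hN m hm k hk]

end Resolvent

/-! ## The Lumer–Phillips theorem in Hilbert spaces -/

section LumerPhillips

variable {X : Type*} [NormedAddCommGroup X] [InnerProductSpace ℂ X] [CompleteSpace X]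

/-- Convergence on the dense domain extends to all of `X` because the operators `c R` are
contractions. -/
lemma IsResolvent.tendsto_smul_apply {L : X →ₗ.[ℂ] X}
    (hL : ∀ x : L.domain, (inner ℂ (x : X) (L x)).re ≤ 0) {c : ℕ → ℝ} (hc : ∀ k, 0 < c k)
    (hct : Tendsto c atTop atTop) {R : ℕ → X →L[ℂ] X} (hR : ∀ k, IsResolvent L (c k) (R k))
    (g : X) : Tendsto (fun k => (c k : ℂ) • R k g) atTop (𝓝 g) := by
  rw [Metric.tendsto_atTop]
  intro ε hε
  obtain ⟨x, hx, hgx⟩ := Metric.mem_closure_iff.1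
    ((hR 0).dense_domain (hc 0) hL g) (ε / 3) (by positivity)
  have h1 : Tendsto (fun k => (c k)⁻¹ * ‖L ⟨x, hx⟩‖) atTop (𝓝 0) := by
    simpa using (tendsto_inv_atTop_zero.comp hct).mul_const ‖L ⟨x, hx⟩‖
  obtain ⟨N, hN⟩ := eventually_atTop.1 (h1.eventually (gt_mem_nhds (by positivity : 0 < ε / 3)))
  refine ⟨N, fun k hk => ?_⟩
  rw [dist_eq_norm] at hgx ⊢
  have h2 := (hR k).norm_smul_apply_sub_le (hc k) hL ⟨x, hx⟩
  have h3 : ‖(c k : ℂ) • R k (g - x)‖ ≤ ‖g - x‖ := by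
    rw [norm_smul, Complex.norm_real, Real.norm_of_nonneg (hc k).le]
    exact (hR k).norm_apply_le hL _
  have h4 : (c k : ℂ) • R k g - g
      = (c k : ℂ) • R k (g - x) + ((c k : ℂ) • R k x - x) - (g - x) := by
    rw [map_sub, smul_sub]
    abel
  calc ‖(c k : ℂ) • R k g - g‖
      ≤ ‖(c k : ℂ) • R k (g - x)‖ + ‖(c k : ℂ) • R k x - x‖ + ‖g - x‖ := by
        rw [h4]
        exact (norm_sub_le _ _).trans (by gcongr; exact norm_add_le _ _)
    _ < ε := by linarith [hN k hk]

lemma IsResolvent.tendsto_yosida {L : X →ₗ.[ℂ] X}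
    (hL : ∀ x : L.domain, (inner ℂ (x : X) (L x)).re ≤ 0) {c : ℕ → ℝ} (hc : ∀ k, 0 < c k)
    (hct : Tendsto c atTop atTop) {R : ℕ → X →L[ℂ] X} (hR : ∀ k, IsResolvent L (c k) (R k))
    (x : L.domain) : Tendsto (fun k => yosida (c k) (R k) x) atTop (𝓝 (L x)) :=
  (IsResolvent.tendsto_smul_apply hL hc hct hR (L x)).congr fun k =>
    ((hR k).yosida_apply_mem x).symm

/-- The semigroups generated by dissipative operators that are dominated by `L` are strongly
continuous at `0`, uniformly in the generator. -/
lemma exists_pos_forall_norm_exp_smul_sub_lt {L : X →ₗ.[ℂ] X} (hD : Dense (L.domain : Set X))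
    {B : ℕ → X →L[ℂ] X} (hB : ∀ k x, (inner ℂ x (B k x)).re ≤ 0)
    (hBL : ∀ k (x : L.domain), ‖B k x‖ ≤ ‖L x‖) (g : X) {ε : ℝ} (hε : 0 < ε) :
    ∃ δ : ℝ, 0 < δ ∧ ∀ s ∈ Ico 0 δ, ∀ k, ‖(NormedSpace.exp (s • B k) : X →L[ℂ] X) g - g‖ ≤ ε := by
  obtain ⟨x, hx, hgx⟩ := Metric.mem_closure_iff.1 (hD g) (ε / 3) (by positivity)
  rw [dist_eq_norm] at hgx
  have hM : 0 < ‖L ⟨x, hx⟩‖ + 1 := by positivity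
  refine ⟨ε / 3 / (‖L ⟨x, hx⟩‖ + 1), by positivity, fun s hs k => ?_⟩
  have h1 := norm_exp_smul_sub_self_le (hB k) x hs.1
  have h2 : s * ‖B k x‖ ≤ ε / 3 := by
    have h3 := hs.2
    rw [lt_div_iff₀ hM] at h3
    nlinarith [hBL k ⟨x, hx⟩, hs.1]
  have h3 := norm_exp_smul_apply_le (hB k) (g - x) hs.1
  have h4 : (NormedSpace.exp (s • B k) : X →L[ℂ] X) g - g =
      (NormedSpace.exp (s • B k) : X →L[ℂ] X) (g - x) +
        ((NormedSpace.exp (s • B k) : X →L[ℂ] X) x - x) - (g - x) := by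
    rw [map_sub]
    abel
  rw [h4]
  refine (norm_sub_le _ _).trans ?_
  have := norm_add_le ((NormedSpace.exp (s • B k) : X →L[ℂ] X) (g - x))
    ((NormedSpace.exp (s • B k) : X →L[ℂ] X) x - x)
  linarith

/-- **Lumer–Phillips theorem** in Hilbert spaces: a dissipative operator `L` such that `c - L` is
surjective for some `c > 0` generates a strongly continuous contraction semigroup. -/
theorem generatesContractionSemigroup_of_dissipative {L : X →ₗ.[ℂ] X}
    (hL : ∀ x : L.domain, (inner ℂ (x : X) (L x)).re ≤ 0) {c : ℝ} (hc : 0 < c)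
    (hs : ∀ g, ∃ x : L.domain, (c : ℂ) • (x : X) - L x = g) :
    GeneratesContractionSemigroup L := by
  have hres : ∀ k : ℕ, ∃ R : X →L[ℂ] X, IsResolvent L ((k : ℝ) + 1) R := fun k =>
    exists_isResolvent_of_surjective hL hc hs (by positivity)
  choose R hR using hres
  have hk : ∀ k : ℕ, 0 < (k : ℝ) + 1 := fun k => by positivity
  have hkt : Tendsto (fun k : ℕ => (k : ℝ) + 1) atTop atTop :=
    tendsto_atTop_add_const_right _ _ tendsto_natCast_atTop_atTop
  have hD : Dense (L.domain : Set X) := (hR 0).dense_domain (hk 0) hL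
  set B : ℕ → X →L[ℂ] X := fun k => yosida ((k : ℝ) + 1) (R k) with hBdef
  have hB : ∀ k x, (inner ℂ x (B k x)).re ≤ 0 := fun k =>
    (hR k).re_inner_yosida_nonpos (hk k) hL
  have hBL : ∀ k (x : L.domain), ‖B k x‖ ≤ ‖L x‖ := fun k x => by
    rw [hBdef, (hR k).yosida_apply_mem x, norm_smul, Complex.norm_real,
      Real.norm_of_nonneg (hk k).le]
    exact (hR k).norm_apply_le hL _
  have hBt : ∀ x : L.domain, Tendsto (fun k => B k x) atTop (𝓝 (L x)) :=
    IsResolvent.tendsto_yosida hL hk hkt hR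
  have hcau : ∀ (t : ℝ≥0) x, CauchySeq fun k => (NormedSpace.exp ((t : ℝ) • B k) : X →L[ℂ] X) x := by
    intro t
    refine cauchySeq_of_dense hD (fun k x => norm_exp_smul_apply_le (hB k) x t.2) fun x hx => ?_
    rw [Metric.cauchySeq_iff]
    intro ε hε
    have ht : 0 < (t : ℝ) + 1 := by positivity
    obtain ⟨N, hN⟩ := Metric.cauchySeq_iff.1 (hBt ⟨x, hx⟩).cauchySeq (ε / (t + 1)) (by positivity)
    refine ⟨N, fun m hm k hk' => ?_⟩
    rw [dist_eq_norm]
    have h1 := norm_exp_smul_sub_exp_smul_le (hB m) (hB k) ((hR m).commute_yosida (hR k)) x t.2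
    have h2 := hN m hm k hk'
    rw [dist_eq_norm, lt_div_iff₀ ht] at h2
    have h3 := norm_nonneg (B m x - B k x)
    change ‖B m x - B k x‖ * ((t : ℝ) + 1) < ε at h2
    change _ ≤ (t : ℝ) * _ at h1
    refine h1.trans_lt ?_
    nlinarith
  have hlim : ∀ (t : ℝ≥0), ∃ S : X →L[ℂ] X, ∀ x,
      Tendsto (fun k => (NormedSpace.exp ((t : ℝ) • B k) : X →L[ℂ] X) x) atTop (𝓝 (S x)) := by
    intro t
    choose f hf using fun x => cauchySeq_tendsto_of_complete (hcau t x)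
    exact ⟨continuousLinearMapOfTendsto _ (tendsto_pi_nhds.2 hf), hf⟩
  choose T hT using hlim
  have hTn : ∀ t x, ‖T t x‖ ≤ ‖x‖ := fun t x =>
    le_of_tendsto (hT t x).norm (Eventually.of_forall fun k => norm_exp_smul_apply_le (hB k) x t.2)
  have hT0 : T 0 = ContinuousLinearMap.id ℂ X := by
    ext x
    refine tendsto_nhds_unique (hT 0 x) ?_
    simp [NormedSpace.exp_zero]
  have hTadd : ∀ s t x, T (s + t) x = T s (T t x) := by
    intro s t x
    refine tendsto_nhds_unique (hT (s + t) x) ?_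
    -- The operators vary together with their argument; contractivity absorbs the error `exp(tB_k) x
    -- - T_t x`.
    have h1 : Tendsto (fun k => (NormedSpace.exp ((s : ℝ) • B k) : X →L[ℂ] X)
        ((NormedSpace.exp ((t : ℝ) • B k) : X →L[ℂ] X) x - T t x)) atTop (𝓝 0) := by
      refine squeeze_zero_norm (fun k => norm_exp_smul_apply_le (hB k) _ s.2) ?_
      simpa using ((hT t x).sub_const (T t x)).norm
    have h2 := h1.add (hT s (T t x))
    rw [zero_add] at h2
    refine h2.congr fun k => ?_
    rw [map_sub, sub_add_cancel, NNReal.coe_add, exp_add_smul_apply]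
  have hunif : ∀ (g : X) {ε : ℝ}, 0 < ε → ∃ δ : ℝ, 0 < δ ∧ ∀ t : ℝ≥0, (t : ℝ) < δ → ‖T t g - g‖ ≤ ε := by
    intro g ε hε
    obtain ⟨δ, hδ, h⟩ := exists_pos_forall_norm_exp_smul_sub_lt hD hB hBL g hε
    exact ⟨δ, hδ, fun t ht => le_of_tendsto ((hT t g).sub_const g).norm
      (Eventually.of_forall fun k => h t ⟨t.2, ht⟩ k)⟩
  -- The semigroup law and contractivity reduce continuity at every time to continuity at `0`.
  have hdist : ∀ s t g, ‖T s g - T t g‖ ≤ ‖T (max s t - min s t) g - g‖ := by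
    have aux : ∀ s t g, s ≤ t → ‖T t g - T s g‖ ≤ ‖T (t - s) g - g‖ := by
      intro s t g hst
      have : T t g = T s (T (t - s) g) := by rw [← hTadd, add_tsub_cancel_of_le hst]
      rw [this, ← map_sub]
      exact hTn _ _
    intro s t g
    rcases le_total s t with h | h
    · rw [max_eq_right h, min_eq_left h, norm_sub_rev]
      exact aux s t g h
    · rw [max_eq_left h, min_eq_right h]
      exact aux t s g h
  have hcont : ∀ f : X, Continuous fun t : ℝ≥0 => T t f := by
    intro f
    rw [Metric.continuous_iff]
    intro t ε hε
    obtain ⟨δ, hδ, h⟩ := hunif f (half_pos hε)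
    refine ⟨δ, hδ, fun s hst => ?_⟩
    rw [dist_eq_norm]
    refine ((hdist s t f).trans (h _ ?_)).trans_lt (half_lt_self hε)
    rw [NNReal.coe_sub min_le_max, NNReal.coe_max, NNReal.coe_min, max_sub_min_eq_abs']
    exact hst
  -- `L` is contained in the generator. In the estimate one `ε / 3` comes from `B_k x → L x` and the
  -- other from strong continuity at `L x`, uniform in `k`; so `k → ∞` may be taken at fixed `t`.
  have hgen : ∀ x : L.domain, Tendsto (fun t : ℝ≥0 => ((t : ℝ)⁻¹ : ℂ) • (T t x - x))
      (𝓝[>] 0) (𝓝 (L x)) := by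
    intro x
    rw [Metric.tendsto_nhds]
    intro ε hε
    obtain ⟨δ, hδ, h⟩ := exists_pos_forall_norm_exp_smul_sub_lt hD hB hBL (L x)
      (by positivity : 0 < ε / 3)
    have hev : ∀ᶠ t : ℝ≥0 in 𝓝[>] 0, (t : ℝ) < δ :=
      nhdsWithin_le_nhds (NNReal.continuous_coe.tendsto 0 |>.eventually (gt_mem_nhds hδ))
    filter_upwards [hev, self_mem_nhdsWithin] with t ht htpos
    have htp : 0 < (t : ℝ) := htpos
    obtain ⟨N, hN⟩ := Metric.tendsto_atTop.1 (hBt x) (ε / 3) (by positivity)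
    have key : ‖T t x - x - (t : ℝ) • L x‖ ≤ (2 * (ε / 3)) * t := by
      refine le_of_tendsto (((hT t x).sub_const (x : X)).sub_const ((t : ℝ) • L x)).norm
        (eventually_atTop.2 ⟨N, fun k hkN => norm_exp_smul_sub_self_sub_le _ _ t.2 fun s hst => ?_⟩)
      have h1 := h s ⟨hst.1, hst.2.trans ht⟩ k
      have h2 := norm_exp_smul_apply_le (hB k) (B k x - L x) hst.1
      have h3 := hN k hkN
      rw [dist_eq_norm] at h3
      have h4 : (NormedSpace.exp (s • B k) : X →L[ℂ] X) (B k x) - L x =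
          (NormedSpace.exp (s • B k) : X →L[ℂ] X) (B k x - L x) +
            ((NormedSpace.exp (s • B k) : X →L[ℂ] X) (L x) - L x) := by
        rw [map_sub]
        abel
      rw [h4]
      refine (norm_add_le _ _).trans ?_
      linarith
    rw [dist_eq_norm]
    have h5 : ((t : ℝ)⁻¹ : ℂ) • (T t x - x) - L x =
        ((t : ℝ)⁻¹ : ℂ) • (T t x - x - (t : ℝ) • L x) := by
      have h0 : ((t : ℝ) : ℂ) ≠ 0 := Complex.ofReal_ne_zero.2 htp.ne'
      rw [smul_sub _ (T t x - x), ← Complex.coe_smul (t : ℝ) (L x), smul_smul, inv_mul_cancel₀ h0,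
        one_smul]
    rw [h5, norm_smul, norm_inv, Complex.norm_real, Real.norm_of_nonneg htp.le,
      inv_mul_eq_div, div_lt_iff₀ htp]
    nlinarith
  refine ⟨T, ⟨hT0, fun s t => ContinuousLinearMap.ext (hTadd s t), hcont, fun t =>
    (T t).opNorm_le_bound zero_le_one fun x => by simpa using hTn t x⟩, fun f g => ?_⟩
  constructor
  · rw [LinearPMap.mem_graph_iff]
    rintro ⟨x, hx, hxg⟩
    dsimp only at hx hxg
    rw [← hx, ← hxg]
    exact hgen x
  -- The generator is no larger than `L`. Choose `x` in the domain with `x - L x = f - g`; then `y =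
  -- f - x` has difference quotients tending to `y` itself. Contractivity gives `Re ⟨y, T_t y - y⟩ ≤
  -- 0`, so `‖y‖² ≤ 0` and `f = x`.
  · intro h
    obtain ⟨x, hx⟩ : ∃ x : L.domain, ((1 : ℝ) : ℂ) • (x : X) - L x = f - g := by
      obtain ⟨S, hS⟩ := exists_isResolvent_of_surjective hL hc hs one_pos
      exact ⟨⟨S (f - g), hS.mem _⟩, hS.sub_apply (f - g)⟩
    rw [Complex.ofReal_one, one_smul] at hx
    have h1 : Tendsto (fun t : ℝ≥0 => ((t : ℝ)⁻¹ : ℂ) • (T t (f - x) - (f - x))) (𝓝[>] 0)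
        (𝓝 (f - x)) := by
      have h2 := h.sub (hgen x)
      have h3 : g - L x = f - x := by
        rw [sub_eq_iff_eq_add] at hx
        rw [sub_eq_iff_eq_add, sub_add_eq_add_sub, eq_sub_iff_add_eq, ← sub_eq_zero]
        rw [hx]
        abel
      rw [h3] at h2
      refine h2.congr fun t => ?_
      rw [← smul_sub, map_sub]
      congr 1
      abel
    have h4 : (inner ℂ (f - x) (f - (x : X))).re ≤ 0 := by
      have h5 := (Complex.continuous_re.tendsto _).comp
        ((tendsto_const_nhds (x := f - (x : X))).inner (𝕜 := ℂ) h1)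
      refine le_of_tendsto h5 (Eventually.of_forall fun t => ?_)
      simp only [Function.comp_apply]
      have h6 : (inner ℂ (f - (x : X)) (T t (f - x))).re ≤ ‖f - (x : X)‖ * ‖f - (x : X)‖ :=
        (Complex.re_le_norm _).trans ((norm_inner_le_norm _ _).trans (by gcongr; exact hTn _ _))
      rw [inner_smul_right, ← Complex.ofReal_inv, Complex.re_ofReal_mul, inner_sub_right,
        Complex.sub_re, re_inner_self_eq]
      exact mul_nonpos_of_nonneg_of_nonpos (inv_nonneg.2 t.2) (by nlinarith)
    rw [re_inner_self_eq] at h4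
    have h7 : f - (x : X) = 0 := norm_eq_zero.1 (pow_eq_zero_iff two_ne_zero |>.1
      (le_antisymm h4 (sq_nonneg _)))
    have h8 : (x : X) = f := (sub_eq_zero.1 h7).symm
    rw [LinearPMap.mem_graph_iff]
    refine ⟨x, h8, ?_⟩
    rw [h8] at hx
    exact sub_right_injective hx

end LumerPhillips

/-! ## Primitives of square integrable functions -/

section Primitive

variable {n : ℕ} {α β : ℝ}

lemma L2.intervalIntegrable (f : L2 n α β) (a b : ℝ) :
    IntervalIntegrable f (volume.restrict (Ioo α β)) a b :=
  (L2.integrable f).intervalIntegrable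

/-- The primitive of `f` vanishing at `α`. -/
def prim (f : L2 n α β) (x : ℝ) : EuclideanSpace ℂ (Fin n) :=
  ∫ y in α..x, f y ∂(volume.restrict (Ioo α β))

lemma continuous_prim (f : L2 n α β) : Continuous (prim f) :=
  intervalIntegral.continuous_primitive (L2.intervalIntegrable f) α

lemma prim_left (f : L2 n α β) : prim f α = 0 := intervalIntegral.integral_same

lemma prim_add (f g : L2 n α β) (x : ℝ) : prim (f + g) x = prim f x + prim g x := by
  rw [prim, prim, prim, ← intervalIntegral.integral_add (L2.intervalIntegrable f α x)
    (L2.intervalIntegrable g α x)]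
  refine intervalIntegral.integral_congr_ae_restrict (ae_restrict_of_ae ?_)
  exact Lp.coeFn_add f g

lemma prim_smul (c : ℂ) (f : L2 n α β) (x : ℝ) : prim (c • f) x = c • prim f x := by
  rw [prim, prim, ← intervalIntegral.integral_smul]
  refine intervalIntegral.integral_congr_ae_restrict (ae_restrict_of_ae ?_)
  exact Lp.coeFn_smul c f

lemma prim_compLpL (T : EuclideanSpace ℂ (Fin n) →L[ℂ] EuclideanSpace ℂ (Fin n))
    (f : L2 n α β) (x : ℝ) :
    prim (T.compLpL 2 (volume.restrict (Ioo α β)) f) x = T (prim f x) := by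
  rw [prim, prim, ← T.intervalIntegral_comp_comm (L2.intervalIntegrable f α x)]
  refine intervalIntegral.integral_congr_ae_restrict (ae_restrict_of_ae ?_)
  exact T.coeFn_compLpL f

/-- A bound for the inclusion of `L²` into `L¹`. -/
def primBound (α β : ℝ) : ℝ :=
  ((volume.restrict (Ioo α β)) univ ^ (1 / (1 : ENNReal).toReal - 1 / (2 : ENNReal).toReal)).toReal

lemma norm_prim_le (f : L2 n α β) (x : ℝ) : ‖prim f x‖ ≤ primBound α β * ‖f‖ := by
  have h1 : ‖prim f x‖ ≤ ∫ y, ‖f y‖ ∂(volume.restrict (Ioo α β)) :=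
    intervalIntegral.norm_integral_le_integral_norm_uIoc.trans
      (setIntegral_le_integral (L2.integrable f).norm (ae_of_all _ fun _ => norm_nonneg _))
  refine h1.trans ?_
  rw [integral_norm_eq_lintegral_enorm (Lp.aestronglyMeasurable f), ← eLpNorm_one_eq_lintegral_enorm,
    Lp.norm_def, primBound, ← ENNReal.toReal_mul, mul_comm]
  refine ENNReal.toReal_mono (ENNReal.mul_ne_top (Lp.eLpNorm_ne_top f) ?_)
    (eLpNorm_le_eLpNorm_mul_rpow_measure_univ (by norm_num) (Lp.aestronglyMeasurable f))
  exact ENNReal.rpow_ne_top_of_nonneg (by norm_num) (measure_ne_top _ _)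

lemma memLp_prim (f : L2 n α β) : MemLp (prim f) 2 (volume.restrict (Ioo α β)) :=
  MemLp.of_bound (continuous_prim f).aestronglyMeasurable _ (ae_of_all _ (norm_prim_le f))

/-! ### Primitives, integrals and constants as bounded operators -/

variable (n α β) in
/-- Integration from `α` as a bounded operator on `L²`. -/
def primL : L2 n α β →L[ℂ] L2 n α β :=
  LinearMap.mkContinuous
    { toFun := fun f => (memLp_prim f).toLp _
      map_add' := fun f g => by
        rw [← MemLp.toLp_add]
        exact MemLp.toLp_congr _ _ (ae_of_all _ (prim_add f g))
      map_smul' := fun c f => by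
        rw [RingHom.id_apply, ← MemLp.toLp_const_smul]
        exact MemLp.toLp_congr _ _ (ae_of_all _ (prim_smul c f)) }
    ((measureUnivNNReal (volume.restrict (Ioo α β)) : ℝ) ^ (2 : ENNReal).toReal⁻¹ * primBound α β)
    fun f => by
      rw [mul_assoc]
      refine Lp.norm_le_of_ae_bound ((norm_nonneg _).trans (norm_prim_le f α)) ?_
      filter_upwards [(memLp_prim f).coeFn_toLp] with x hx
      exact (congrArg norm hx).trans_le (norm_prim_le f x)

lemma coeFn_primL (f : L2 n α β) : primL n α β f =ᵐ[volume.restrict (Ioo α β)] prim f :=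
  (memLp_prim f).coeFn_toLp

variable (n α β) in
/-- Integration over `(α, β)` as a bounded operator on `L²`. -/
def integralL : L2 n α β →L[ℂ] EuclideanSpace ℂ (Fin n) :=
  LinearMap.mkContinuous
    { toFun := fun f => prim f β
      map_add' := fun f g => prim_add f g β
      map_smul' := fun c f => prim_smul c f β } (primBound α β) fun f => norm_prim_le f β

lemma integralL_apply (f : L2 n α β) : integralL n α β f = prim f β := rfl

variable (n α β) in
/-- The inclusion of the constants. -/
abbrev constL : EuclideanSpace ℂ (Fin n) →L[ℂ] L2 n α β :=
  Lp.constL 2 (volume.restrict (Ioo α β)) ℂ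

lemma coeFn_constL (a : EuclideanSpace ℂ (Fin n)) :
    constL n α β a =ᵐ[volume.restrict (Ioo α β)] fun _ => a :=
  Lp.coeFn_const 2 (volume.restrict (Ioo α β)) a

lemma coeFn_constL_add_primL (a : EuclideanSpace ℂ (Fin n)) (g : L2 n α β) :
    (constL n α β a + primL n α β g : L2 n α β) =ᵐ[volume.restrict (Ioo α β)]
      fun x => a + prim g x := by
  filter_upwards [Lp.coeFn_add (constL n α β a) (primL n α β g), coeFn_constL (α := α) (β := β) a,
    coeFn_primL g] with x h1 h2 h3
  rw [h1, Pi.add_apply, h2, h3]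

lemma compLpL_constL (T : EuclideanSpace ℂ (Fin n) →L[ℂ] EuclideanSpace ℂ (Fin n))
    (a : EuclideanSpace ℂ (Fin n)) :
    T.compLpL 2 (volume.restrict (Ioo α β)) (constL n α β a) = constL n α β (T a) := by
  refine Lp.ext ?_
  filter_upwards [T.coeFn_compLpL (constL n α β a), coeFn_constL (α := α) (β := β) a,
    coeFn_constL (α := α) (β := β) (T a)] with x h1 h2 h3
  rw [h1, h2, h3]

lemma compLpL_primL (T : EuclideanSpace ℂ (Fin n) →L[ℂ] EuclideanSpace ℂ (Fin n))
    (g : L2 n α β) :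
    T.compLpL 2 (volume.restrict (Ioo α β)) (primL n α β g) =
      primL n α β (T.compLpL 2 (volume.restrict (Ioo α β)) g) := by
  refine Lp.ext ?_
  filter_upwards [T.coeFn_compLpL (primL n α β g), coeFn_primL g,
    coeFn_primL (T.compLpL 2 (volume.restrict (Ioo α β)) g)] with x h1 h2 h3
  rw [h1, h2, h3, prim_compLpL]

/-- The primitive only depends on the values in `(α, β)`. -/
lemma prim_eq_integral {g : L2 n α β} {u : ℝ → EuclideanSpace ℂ (Fin n)}
    (hu : g =ᵐ[volume.restrict (Ioo α β)] u) {x : ℝ} (hx : x ∈ Icc α β) :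
    prim g x = ∫ y in α..x, u y := by
  rw [prim, intervalIntegral.integral_of_le hx.1, intervalIntegral.integral_of_le hx.1,
    integral_congr_ae (ae_restrict_of_ae hu), Measure.restrict_restrict measurableSet_Ioc,
    integral_Ioc_eq_integral_Ioo]
  refine setIntegral_congr_set ?_
  have h := (Ioo_ae_eq_Ioc (μ := volume) (a := α) (b := x)).symm.inter
    (ae_eq_refl (μ := (volume : Measure ℝ)) (Ioo α β))
  rwa [inter_eq_left.2 (Ioo_subset_Ioo_right hx.2)] at h

lemma prim_eq_sub {g : L2 n α β} {v v' : ℝ → EuclideanSpace ℂ (Fin n)} (hv' : Continuous v')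
    (hv : ∀ x, HasDerivAt v (v' x) x) (hg : g =ᵐ[volume.restrict (Ioo α β)] v')
    {x : ℝ} (hx : x ∈ Icc α β) : prim g x = v x - v α := by
  rw [prim_eq_integral hg hx]
  exact intervalIntegral.integral_eq_sub_of_hasDerivAt (fun y _ => hv y)
    (hv'.intervalIntegrable _ _)

lemma integral_Ioo_eq_intervalIntegral {F : Type*} [NormedAddCommGroup F] [NormedSpace ℝ F]
    (hαβ : α < β) (u : ℝ → F) : ∫ x in Ioo α β, u x = ∫ x in α..β, u x := by
  rw [intervalIntegral.integral_of_le hαβ.le, integral_Ioc_eq_integral_Ioo]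

/-- Integration by parts in `W^{1,2}`. -/
lemma inner_add_inner_eq_sub (hαβ : α < β) (a b : EuclideanSpace ℂ (Fin n)) (g k : L2 n α β) :
    inner ℂ g (constL n α β b + primL n α β k) + inner ℂ (constL n α β a + primL n α β g) k =
      inner ℂ (a + integralL n α β g) (b + integralL n α β k) - inner ℂ a b := by
  -- Both sides are continuous in `(g, k)`, so `g` and `k` may be taken bounded and continuous.
  -- Their primitives are then `C¹`, and the claim is the fundamental theorem of calculus for `⟨G,
  -- K⟩`.
  refine (BoundedContinuousFunction.toLp_denseRange (EuclideanSpace ℂ (Fin n))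
    (volume.restrict (Ioo α β)) ℂ (p := 2) (by norm_num)).induction_on₂
    (p := fun g k : L2 n α β => inner ℂ g (constL n α β b + primL n α β k) +
      inner ℂ (constL n α β a + primL n α β g) k =
      inner ℂ (a + integralL n α β g) (b + integralL n α β k) - inner ℂ a b)
    (isClosed_eq (by fun_prop) (by fun_prop)) (fun u w => ?_) g k
  set g : L2 n α β := BoundedContinuousFunction.toLp 2 _ ℂ u with hg
  set k : L2 n α β := BoundedContinuousFunction.toLp 2 _ ℂ w with hk
  have hgu : g =ᵐ[volume.restrict (Ioo α β)] u := BoundedContinuousFunction.coeFn_toLp _ _ _ _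
  have hkw : k =ᵐ[volume.restrict (Ioo α β)] w := BoundedContinuousFunction.coeFn_toLp _ _ _ _
  set G : ℝ → EuclideanSpace ℂ (Fin n) := fun x => a + ∫ y in α..x, u y with hG
  set K : ℝ → EuclideanSpace ℂ (Fin n) := fun x => b + ∫ y in α..x, w y with hK
  have hGd : ∀ x, HasDerivAt G (u x) x := fun x =>
    (u.continuous.integral_hasStrictDerivAt α x).hasDerivAt.const_add a
  have hKd : ∀ x, HasDerivAt K (w x) x := fun x =>
    (w.continuous.integral_hasStrictDerivAt α x).hasDerivAt.const_add b
  have hGc : Continuous G := continuous_iff_continuousAt.2 fun x => (hGd x).continuousAt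
  have hKc : Continuous K := continuous_iff_continuousAt.2 fun x => (hKd x).continuousAt
  have huc := u.continuous
  have hwc := w.continuous
  have hint : ∀ {v : ℝ → ℂ}, Continuous v → Integrable v (volume.restrict (Ioo α β)) := fun hv =>
    (hv.integrableOn_Icc (a := α) (b := β)).mono_set Ioo_subset_Icc_self
  have hmem : ∀ᵐ x ∂(volume.restrict (Ioo α β)), x ∈ Ioo α β := ae_restrict_mem measurableSet_Ioo
  have e1 : inner ℂ g (constL n α β b + primL n α β k) =
      ∫ x in Ioo α β, inner ℂ (u x) (K x) := by
    rw [L2.inner_def]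
    refine integral_congr_ae ?_
    filter_upwards [hgu, coeFn_constL_add_primL b k, hmem] with x h1 h2 h3
    rw [h1, h2, prim_eq_integral hkw (Ioo_subset_Icc_self h3)]
  have e2 : inner ℂ (constL n α β a + primL n α β g) k =
      ∫ x in Ioo α β, inner ℂ (G x) (w x) := by
    rw [L2.inner_def]
    refine integral_congr_ae ?_
    filter_upwards [hkw, coeFn_constL_add_primL a g, hmem] with x h1 h2 h3
    rw [h1, h2, prim_eq_integral hgu (Ioo_subset_Icc_self h3)]
  have e3 := intervalIntegral.integral_eq_sub_of_hasDerivAt (a := α) (b := β)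
    (fun x _ => (hGd x).inner ℂ (hKd x))
    ((by fun_prop : Continuous fun x => inner ℂ (G x) (w x) + inner ℂ (u x) (K x)).intervalIntegrable
      _ _)
  rw [e1, e2, add_comm, ← integral_add (hint (by fun_prop)) (hint (by fun_prop)),
    integral_Ioo_eq_intervalIntegral hαβ, e3, integralL_apply, integralL_apply,
    prim_eq_integral hgu (right_mem_Icc.2 hαβ.le), prim_eq_integral hkw (right_mem_Icc.2 hαβ.le)]
  simp only [hG, hK, intervalIntegral.integral_same, add_zero]

/-- Integrate by parts against `φ' z`, whose primitive `φ z` vanishes at both ends. Taking for `z`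
the very vector that should vanish yields `⟨z, z⟩ = 0`. -/
lemma hasWeakDeriv_constL_add_primL (hαβ : α < β) (a : EuclideanSpace ℂ (Fin n)) (g : L2 n α β) :
    HasWeakDeriv (constL n α β a + primL n α β g) g := by
  intro φ h1 h2 h3
  have hdc : Continuous (deriv φ) := h1.continuous_deriv (by simp)
  have hφα : φ α = 0 := image_eq_zero_of_notMem_tsupport fun h => (h3 h).1.false
  have hφβ : φ β = 0 := image_eq_zero_of_notMem_tsupport fun h => (h3 h).2.false
  rw [eq_neg_iff_add_eq_zero, ← inner_self_eq_zero (𝕜 := ℂ)]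
  generalize hz : (∫ x in Ioo α β, deriv φ x • (constL n α β a + primL n α β g : L2 n α β) x) +
    ∫ x in Ioo α β, φ x • g x = z
  conv_lhs => rw [← hz]
  obtain ⟨C, hC⟩ := h2.deriv.exists_bound_of_continuous hdc
  have hm : MemLp (fun x => deriv φ x • z) 2 (volume.restrict (Ioo α β)) :=
    MemLp.of_bound (by fun_prop) (C * ‖z‖) (ae_of_all _ fun x => by
      rw [norm_smul]
      gcongr
      exact hC x)
  set k : L2 n α β := hm.toLp _ with hk
  have hkz : k =ᵐ[volume.restrict (Ioo α β)] fun x => deriv φ x • z := hm.coeFn_toLp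
  have hprim : ∀ x ∈ Icc α β, prim k x = φ x • z := fun x hx => by
    rw [prim_eq_sub (v := fun x => φ x • z) (by fun_prop) (fun y =>
      (h1.differentiable (by simp) y).hasDerivAt.smul_const z) hkz hx, hφα, zero_smul, sub_zero]
  have hib := inner_add_inner_eq_sub hαβ 0 a k g
  rw [integralL_apply k, hprim β (right_mem_Icc.2 hαβ.le), hφβ, zero_smul, add_zero,
    inner_zero_left, inner_zero_left, sub_zero, L2.inner_def, L2.inner_def] at hib
  have e1 : ∫ x in Ioo α β, inner ℂ (k x) ((constL n α β a + primL n α β g : L2 n α β) x) =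
      inner ℂ z (∫ x in Ioo α β, deriv φ x • (constL n α β a + primL n α β g : L2 n α β) x) := by
    rw [← integral_inner (integrable_smul_L2 hdc h2.deriv _)]
    refine integral_congr_ae ?_
    filter_upwards [hkz] with x hx
    rw [hx, inner_smul_left_eq_smul, inner_smul_right_eq_smul]
  have e2 : ∫ x in Ioo α β, inner ℂ ((constL n α β 0 + primL n α β k : L2 n α β) x) (g x) =
      inner ℂ z (∫ x in Ioo α β, φ x • g x) := by
    rw [← integral_inner (integrable_smul_L2 h1.continuous h2 _)]
    refine integral_congr_ae ?_
    filter_upwards [coeFn_constL_add_primL 0 k, ae_restrict_mem measurableSet_Ioo] with x hx hx'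
    rw [hx, hprim x (Ioo_subset_Icc_self hx'), zero_add, inner_smul_left_eq_smul,
      inner_smul_right_eq_smul]
  rw [e1, e2, ← inner_add_right, hz] at hib
  rw [hz, hib]

/-! ## Weak derivatives and absolutely continuous representatives -/

/-- An `L²` function that annihilates all test functions vanishes. -/
lemma eq_zero_of_forall_integral_smul_eq_zero {f : L2 n α β}
    (h : ∀ φ : ℝ → ℝ, ContDiff ℝ ∞ φ → HasCompactSupport φ → tsupport φ ⊆ Ioo α β →
      ∫ x in Ioo α β, φ x • f x = 0) : f = 0 := by
  have key := isOpen_Ioo.ae_eq_zero_of_integral_contDiff_smul_eq_zero (f := f) (μ := volume)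
    (U := Ioo α β) (IntegrableOn.locallyIntegrableOn (L2.integrable f)) (by
      intro φ h1 h2 h3
      rw [← setIntegral_eq_integral_of_forall_compl_eq_zero (s := Ioo α β) (by
        intro x hx
        rw [image_eq_zero_of_notMem_tsupport (fun h => hx (h3 h)), zero_smul])]
      exact h φ h1 h2 h3)
  refine Lp.ext ?_
  filter_upwards [(ae_restrict_iff' measurableSet_Ioo).2 key, Lp.coeFn_zero
    (EuclideanSpace ℂ (Fin n)) 2 (volume.restrict (Ioo α β))] with x hx h0
  rw [hx, h0, Pi.zero_apply]

/-- A test function with vanishing integral is the derivative of a test function. -/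
lemma exists_deriv_eq_of_integral_eq_zero (hαβ : α < β) {θ : ℝ → ℝ} (h1 : ContDiff ℝ ∞ θ)
    (h2 : HasCompactSupport θ) (h3 : tsupport θ ⊆ Ioo α β) (h0 : ∫ x in Ioo α β, θ x = 0) :
    ∃ χ : ℝ → ℝ, ContDiff ℝ ∞ χ ∧ HasCompactSupport χ ∧ tsupport χ ⊆ Ioo α β ∧ deriv χ = θ := by
  obtain ⟨a, b, ha, hb, hab⟩ : ∃ a b, α < a ∧ b < β ∧ tsupport θ ⊆ Icc a b := by
    rcases (tsupport θ).eq_empty_or_nonempty with he | hne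
    -- For empty support the reversed endpoints make `Icc a b` empty.
    · exact ⟨β, α, hαβ, hαβ, he ▸ empty_subset _⟩
    · obtain ⟨a, ha⟩ := h2.isCompact.exists_isLeast hne
      obtain ⟨b, hb⟩ := h2.isCompact.exists_isGreatest hne
      exact ⟨a, b, (h3 ha.1).1, (h3 hb.1).2, fun x hx => ⟨ha.2 hx, hb.2 hx⟩⟩
  have hθ : ∀ x, x ∉ Icc a b → θ x = 0 := fun x hx =>
    image_eq_zero_of_notMem_tsupport fun h => hx (hab h)
  have hd : ∀ x, HasDerivAt (fun x => ∫ y in α..x, θ y) (θ x) x := fun x =>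
    (h1.continuous.integral_hasStrictDerivAt α x).hasDerivAt
  have hderiv : deriv (fun x => ∫ y in α..x, θ y) = θ := funext fun x => (hd x).deriv
  have hsupp : tsupport (fun x => ∫ y in α..x, θ y) ⊆ Icc a b := by
    refine closure_minimal (fun x hx => ?_) isClosed_Icc
    by_contra hxab
    refine hx ?_
    rcases lt_or_ge x a with h | h
    · refine intervalIntegral.integral_zero_ae (ae_of_all _ fun y hy => hθ y fun hy' => ?_)
      have := (uIoc_subset_uIcc hy).2
      exact (max_lt ha h).not_ge (hy'.1.trans this)
    · have hbx : b < x := lt_of_not_ge fun h' => hxab ⟨h, h'⟩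
      have e1 : ∫ y in x..β, θ y = 0 := by
        refine intervalIntegral.integral_zero_ae (ae_of_all _ fun y hy => hθ y fun hy' => ?_)
        have := (uIoc_subset_uIcc hy).1
        exact (lt_min hbx hb).not_ge (this.trans hy'.2)
      rw [integral_Ioo_eq_intervalIntegral hαβ] at h0
      have e2 := intervalIntegral.integral_add_adjacent_intervals (μ := volume)
        (h1.continuous.intervalIntegrable α x) (h1.continuous.intervalIntegrable x β)
      dsimp only
      rw [← h0, ← e2, e1, add_zero]
  refine ⟨fun x => ∫ y in α..x, θ y, ?_, ?_, ?_, hderiv⟩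
  · rw [contDiff_infty_iff_deriv, hderiv]
    exact ⟨fun x => (hd x).differentiableAt, h1⟩
  · exact isCompact_Icc.of_isClosed_subset (isClosed_tsupport _) hsupp
  · exact hsupp.trans (Icc_subset_Ioo ha hb)

/-- Du Bois-Reymond: a function with vanishing weak derivative is constant. -/
lemma HasWeakDeriv.eq_constL (hαβ : α < β) {f : L2 n α β} (hf : HasWeakDeriv f 0) :
    ∃ c, f = constL n α β c := by
  -- Fix a bump `ψ` of integral one supported in `(α, β)`. For a test function `φ` with integral
  -- `m`, `φ - m ψ` is the derivative of a test function, so `∫ φ f = m ∫ ψ f`. Hence `f` is the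
  -- constant `∫ ψ f`.
  let B : ContDiffBump ((α + β) / 2) :=
    { rIn := (β - α) / 8
      rOut := (β - α) / 4
      rIn_pos := by linarith
      rIn_lt_rOut := by linarith }
  set ψ : ℝ → ℝ := B.normed volume with hψ
  have hψ1 : ContDiff ℝ ∞ ψ := B.contDiff_normed
  have hψ2 : HasCompactSupport ψ := B.hasCompactSupport_normed
  have hψ3 : tsupport ψ ⊆ Ioo α β := by
    rw [hψ, B.tsupport_normed_eq, Real.closedBall_eq_Icc]
    change Icc ((α + β) / 2 - (β - α) / 4) ((α + β) / 2 + (β - α) / 4) ⊆ _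
    exact Icc_subset_Ioo (by linarith) (by linarith)
  have hψ4 : ∫ x in Ioo α β, ψ x = 1 := by
    rw [setIntegral_eq_integral_of_forall_compl_eq_zero fun x hx =>
      image_eq_zero_of_notMem_tsupport fun h => hx (hψ3 h)]
    exact B.integral_normed
  have hint : ∀ {φ : ℝ → ℝ}, ContDiff ℝ ∞ φ → HasCompactSupport φ →
      Integrable φ (volume.restrict (Ioo α β)) := fun h1 h2 =>
    (h1.continuous.integrable_of_hasCompactSupport h2).restrict
  set c : EuclideanSpace ℂ (Fin n) := ∫ x in Ioo α β, ψ x • f x with hc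
  refine ⟨c, sub_eq_zero.1 (eq_zero_of_forall_integral_smul_eq_zero fun φ h1 h2 h3 => ?_)⟩
  set m : ℝ := ∫ x in Ioo α β, φ x with hm
  have hmψ : ContDiff ℝ ∞ (fun x => m * ψ x) := contDiff_const.mul hψ1
  have hmψ2 : HasCompactSupport (fun x => m * ψ x) := hψ2.mul_left
  obtain ⟨χ, hχ1, hχ2, hχ3, hχ⟩ := exists_deriv_eq_of_integral_eq_zero hαβ
    (θ := fun x => φ x - m * ψ x) (h1.sub hmψ) (h2.sub hmψ2)
    ((tsupport_sub _ _).trans (union_subset h3 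
      (tsupport_mul_subset_right.trans hψ3)))
    (by rw [integral_sub (hint h1 h2) (hint hmψ hmψ2), integral_const_mul, hψ4, mul_one, sub_self])
  have hw := hf χ hχ1 hχ2 hχ3
  have h0 : ∫ x in Ioo α β, χ x • (0 : L2 n α β) x = 0 := by
    refine integral_eq_zero_of_ae ?_
    filter_upwards [Lp.coeFn_zero (EuclideanSpace ℂ (Fin n)) 2 (volume.restrict (Ioo α β))]
      with x hx
    exact (congrArg (fun y => χ x • y) hx).trans (smul_zero _)
  rw [h0, neg_zero, hχ] at hw
  have e1 : ∫ x in Ioo α β, (φ x - m * ψ x) • f x = (∫ x in Ioo α β, φ x • f x) - m • c := by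
    simp only [sub_smul, mul_smul]
    have hi : Integrable (fun x => m • ψ x • f x) (volume.restrict (Ioo α β)) :=
      (integrable_smul_L2 hψ1.continuous hψ2 f).smul m
    rw [integral_sub (integrable_smul_L2 h1.continuous h2 f) hi, integral_smul]
  have e2 : ∫ x in Ioo α β, φ x • (f - constL n α β c : L2 n α β) x =
      (∫ x in Ioo α β, φ x • f x) - m • c := by
    rw [hm, ← integral_smul_const, ← integral_sub (integrable_smul_L2 h1.continuous h2 f)
      ((hint h1 h2).smul_const c)]
    refine integral_congr_ae ?_
    filter_upwards [Lp.coeFn_sub f (constL n α β c), coeFn_constL (α := α) (β := β) c]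
      with x hx hx'
    rw [hx, Pi.sub_apply, hx', smul_sub]
  rw [e2, ← e1, hw]

/-- Functions in `W^{1,2}` are the primitives of their weak derivatives. -/
lemma hasWeakDeriv_and_hasBoundaryValues_iff (hαβ : α < β) {f g : L2 n α β}
    {a b : EuclideanSpace ℂ (Fin n)} :
    HasWeakDeriv f g ∧ HasBoundaryValues f a b ↔
      f = constL n α β a + primL n α β g ∧ b = a + integralL n α β g := by
  constructor
  · rintro ⟨hfg, u, hu, hfu, rfl, rfl⟩
    -- Subtracting the primitive of `g` leaves weak derivative zero, hence a constant. Continuous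
    -- functions equal a.e. agree on all of `[α, β]`, which identifies this constant and the
    -- endpoint values.
    have h0 := hfg.add ((hasWeakDeriv_constL_add_primL hαβ 0 g).smul (-1))
    rw [map_zero, zero_add, neg_one_smul, neg_one_smul, ← sub_eq_add_neg, add_neg_cancel] at h0
    obtain ⟨c, hc⟩ := h0.eq_constL hαβ
    have hf : f = constL n α β c + primL n α β g := sub_eq_iff_eq_add.1 hc
    have hae : u =ᵐ[volume.restrict (Icc α β)] fun x => c + prim g x := by
      rw [← Measure.restrict_congr_set (Ioo_ae_eq_Icc (μ := volume) (a := α) (b := β))]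
      filter_upwards [hfu, coeFn_constL_add_primL c g] with x h1 h2
      rw [← h1, hf, h2]
    have heq := Measure.eqOn_Icc_of_ae_eq volume hαβ.ne hae hu
      (continuous_const.add (continuous_prim g)).continuousOn
    have hα : u α = c := by simpa [prim_left] using heq (left_mem_Icc.2 hαβ.le)
    have hβ : u β = c + prim g β := heq (right_mem_Icc.2 hαβ.le)
    exact ⟨by rw [hα]; exact hf, by rw [hα, hβ, integralL_apply]⟩
  · rintro ⟨rfl, rfl⟩
    refine ⟨hasWeakDeriv_constL_add_primL hαβ a g, fun x => a + prim g x,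
      (continuous_const.add (continuous_prim g)).continuousOn, coeFn_constL_add_primL a g, ?_, rfl⟩
    simp [prim_left]

/-- `g` is the weak derivative of zero, and a constant that vanishes a.e. on a set of positive
measure is zero. Applied twice, this recovers the initial data of a solution from the solution
itself. -/
lemma constL_add_primL_eq_zero (hαβ : α < β) {a : EuclideanSpace ℂ (Fin n)} {g : L2 n α β}
    (h : constL n α β a + primL n α β g = 0) : a = 0 ∧ g = 0 := by
  have hg : g = 0 := by
    have := hasWeakDeriv_constL_add_primL hαβ a g
    rw [h] at this
    exact this.unique .zero
  refine ⟨?_, hg⟩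
  rw [hg, map_zero, add_zero] at h
  have hae := coeFn_constL (α := α) (β := β) a
  rw [h] at hae
  have : NeBot (ae (volume.restrict (Ioo α β))) := by
    rw [ae_restrict_neBot]
    simp [hαβ]
  obtain ⟨x, hx, hx0⟩ := (hae.and (Lp.coeFn_zero (EuclideanSpace ℂ (Fin n)) 2
    (volume.restrict (Ioo α β)))).exists
  exact hx.symm.trans hx0

end Primitive

/-! ## The boundary value problem -/

section BoundaryValueProblem

variable {n : ℕ} {α β : ℝ} {U V : Submodule ℂ (EuclideanSpace ℂ (Fin n))}

/-- `f` is in the domain, with second derivative `f₂`, iff it is a twofold primitive of `f₂` with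
boundary values in `U` and `V`. -/
lemma exists_mem_bvpDomain_secondDeriv_eq_iff (hαβ : α < β) {f f₂ : L2 n α β} :
    (∃ h : f ∈ bvpDomain n α β U V, secondDeriv n α β U V ⟨f, h⟩ = f₂) ↔
      ∃ a ∈ U, ∃ c ∈ V, ∃ f₁ : L2 n α β,
        f = constL n α β a + primL n α β f₁ ∧ f₁ = constL n α β c + primL n α β f₂ ∧
        a + integralL n α β f₁ ∈ U ∧ c + integralL n α β f₂ ∈ V := by
  constructor
  · rintro ⟨⟨f₁, g, h1, h2, ⟨a, ha, b, hb, h3⟩, ⟨c, hc, d, hd, h4⟩⟩, rfl⟩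
    have hg : secondDeriv n α β U V ⟨f, f₁, g, h1, h2, ⟨a, ha, b, hb, h3⟩, ⟨c, hc, d, hd, h4⟩⟩ = g :=
      (secondDeriv_spec _).unique ⟨f₁, h1, h2⟩
    rw [hg]
    obtain ⟨hf, rfl⟩ := (hasWeakDeriv_and_hasBoundaryValues_iff hαβ).1 ⟨h1, h3⟩
    obtain ⟨hf₁, rfl⟩ := (hasWeakDeriv_and_hasBoundaryValues_iff hαβ).1 ⟨h2, h4⟩
    exact ⟨a, ha, c, hc, f₁, hf, hf₁, hb, hd⟩
  · rintro ⟨a, ha, c, hc, f₁, hf, hf₁, hb, hd⟩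
    obtain ⟨h1, h3⟩ := (hasWeakDeriv_and_hasBoundaryValues_iff hαβ).2 ⟨hf, rfl⟩
    obtain ⟨h2, h4⟩ := (hasWeakDeriv_and_hasBoundaryValues_iff hαβ).2 ⟨hf₁, rfl⟩
    exact ⟨⟨f₁, f₂, h1, h2, ⟨a, ha, _, hb, h3⟩, ⟨c, hc, _, hd, h4⟩⟩,
      (secondDeriv_spec _).unique ⟨f₁, h1, h2⟩⟩

/-! ### Dissipativity of `-H` and surjectivity of `r + H` -/

variable (A : Matrix (Fin n) (Fin n) ℂ)

variable (α β) in
/-- Pointwise multiplication by a matrix. -/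
abbrev matrixL : L2 n α β →L[ℂ] L2 n α β :=
  (Matrix.toEuclideanCLM (𝕜 := ℂ) A).compLpL 2 (volume.restrict (Ioo α β))

lemma neg_operatorH_apply {f : L2 n α β} (h : f ∈ bvpDomain n α β U V) :
    (-(operatorH α β A U V)) ⟨f, h⟩ = matrixL α β A (secondDeriv n α β U V ⟨f, h⟩) :=
  neg_neg _

lemma matrixL_mul_apply (A' : Matrix (Fin n) (Fin n) ℂ) (h : A * A' = 1) (f : L2 n α β) :
    matrixL α β A (matrixL α β A' f) = f := by
  refine Lp.ext ?_
  filter_upwards [(Matrix.toEuclideanCLM (𝕜 := ℂ) A).coeFn_compLpL (matrixL α β A' f),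
    (Matrix.toEuclideanCLM (𝕜 := ℂ) A').coeFn_compLpL f] with x h1 h2
  rw [h1, h2, ← mul_apply_eq_comp, ← map_mul, h, map_one]
  rfl

variable {A}

lemma re_inner_matrixL_nonneg (hacc : IsAccretive A) (f : L2 n α β) :
    0 ≤ (inner ℂ f (matrixL α β A f)).re := by
  rw [L2.inner_def]
  have h := integral_re (𝕜 := ℂ) (L2.integrable_inner f (matrixL α β A f))
  change _ = (∫ x in Ioo α β, inner ℂ (f x) (matrixL α β A f x)).re at h
  rw [← h]
  refine integral_nonneg_of_ae ?_
  filter_upwards [(Matrix.toEuclideanCLM (𝕜 := ℂ) A).coeFn_compLpL f] with x hx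
  rw [hx]
  exact hacc (f x)

/-- `A f'` is again constant plus primitive, with initial value `A c` and derivative `A f''`.
Integrating `⟨f, A f''⟩` by parts gives boundary terms in `⟨U, AV⟩ = 0`, leaving `-⟨f', A f'⟩`. -/
lemma re_inner_neg_operatorH_nonpos (hαβ : α < β) (hacc : IsAccretive A)
    (hAVU : V.map (Matrix.toEuclideanCLM (𝕜 := ℂ) A).toLinearMap ⟂ U)
    (f : (-(operatorH α β A U V)).domain) :
    (inner ℂ (f : L2 n α β) ((-(operatorH α β A U V)) f)).re ≤ 0 := by
  obtain ⟨f, hfU⟩ := f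
  rw [show (-(operatorH α β A U V)) ⟨f, hfU⟩ = _ from neg_operatorH_apply A hfU]
  obtain ⟨a, ha, c, hc, f₁, hf, hf₁, hb, hd⟩ :=
    (exists_mem_bvpDomain_secondDeriv_eq_iff hαβ).1 ⟨hfU, rfl⟩
  set f₂ := secondDeriv n α β U V ⟨f, hfU⟩
  set T := Matrix.toEuclideanCLM (𝕜 := ℂ) A
  have hort : ∀ u ∈ U, ∀ v ∈ V, inner ℂ u (T v) = 0 := fun u hu v hv =>
    Submodule.isOrtho_iff_inner_eq.1 hAVU.symm u hu (T v) (Submodule.mem_map_of_mem hv)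
  have h1 : matrixL α β A f₁ = constL n α β (T c) + primL n α β (matrixL α β A f₂) := by
    conv_lhs => rw [hf₁]
    rw [map_add, compLpL_constL, compLpL_primL]
  have h2 : integralL n α β (matrixL α β A f₂) = T (integralL n α β f₂) := prim_compLpL T f₂ β
  have h3 := inner_add_inner_eq_sub hαβ a (T c) f₁ (matrixL α β A f₂)
  rw [← hf, ← h1, h2, ← map_add, hort _ hb _ hd, hort _ ha _ hc, sub_zero] at h3
  have h4 := congrArg Complex.re h3
  rw [Complex.add_re, Complex.zero_re] at h4
  have := re_inner_matrixL_nonneg hacc f₁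
  linarith

/-- The linear system of boundary conditions is uniquely solvable as soon as its homogeneous version
is. -/
lemma exists_linearMap_add_mem {E W : Type*} [AddCommGroup E] [Module ℂ E] [FiniteDimensional ℂ E]
    [AddCommGroup W] [Module ℂ W] {U V : Submodule ℂ E} (hUV : IsCompl U V)
    (b d : (E × E) × W →ₗ[ℂ] E)
    (hinj : ∀ a ∈ U, ∀ c ∈ V, b ((a, c), 0) ∈ U → d ((a, c), 0) ∈ V → a = 0 ∧ c = 0) (w : W) :
    ∃ a ∈ U, ∃ c ∈ V, b ((a, c), w) ∈ U ∧ d ((a, c), w) ∈ V := by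
  let Q : (E × E) × W →ₗ[ℂ] (E ⧸ U) × (E ⧸ V) := (U.mkQ ∘ₗ b).prod (V.mkQ ∘ₗ d)
  let P : U × V →ₗ[ℂ] (E ⧸ U) × (E ⧸ V) :=
    Q ∘ₗ LinearMap.inl ℂ (E × E) W ∘ₗ U.subtype.prodMap V.subtype
  have hQ : ∀ x, Q x = 0 ↔ b x ∈ U ∧ d x ∈ V := fun x => by
    simp [Q, Prod.ext_iff]
  have hP : ∀ p : U × V, P p = Q (((p.1 : E), (p.2 : E)), 0) := fun p => rfl
  have hPinj : Function.Injective P := by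
    refine (injective_iff_map_eq_zero P).2 fun p hp => ?_
    rw [hP, hQ] at hp
    obtain ⟨h1, h2⟩ := hinj _ p.1.2 _ p.2.2 hp.1 hp.2
    exact Prod.ext (Subtype.ext h1) (Subtype.ext h2)
  -- The codimensions of complementary subspaces are each other's dimensions.
  have hdim : Module.finrank ℂ (U × V) = Module.finrank ℂ ((E ⧸ U) × (E ⧸ V)) := by
    rw [Module.finrank_prod, Module.finrank_prod]
    have h1 := U.finrank_quotient_add_finrank
    have h2 := V.finrank_quotient_add_finrank
    have h3 := Submodule.finrank_add_eq_of_isCompl hUV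
    omega
  obtain ⟨p, hp⟩ := (LinearMap.injective_iff_surjective_of_finrank_eq_finrank hdim).1 hPinj
    (-Q ((0, 0), w))
  refine ⟨p.1, p.1.2, p.2, p.2.2, (hQ _).1 ?_⟩
  have : ((((p.1 : E), (p.2 : E)), w) : (E × E) × W) =
      (((p.1 : E), (p.2 : E)), 0) + ((0, 0), w) := by simp
  rw [this, map_add, ← hP, hp, neg_add_cancel]

/-- For small `r > 0`, the initial value problem `r f - A f'' = g`, `f(α) = a`, `f'(α) = c` has a
solution depending linearly on `((a, c), g)`. -/
lemma exists_initialValueProblem_solution (α β : ℝ) (A' : Matrix (Fin n) (Fin n) ℂ) :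
    ∃ r : ℝ, 0 < r ∧ ∃ F F₁ F₂ : (EuclideanSpace ℂ (Fin n) × EuclideanSpace ℂ (Fin n)) ×
      L2 n α β →ₗ[ℂ] L2 n α β, ∀ a c g,
        F ((a, c), g) = constL n α β a + primL n α β (F₁ ((a, c), g)) ∧
        F₁ ((a, c), g) = constL n α β c + primL n α β (F₂ ((a, c), g)) ∧
        F₂ ((a, c), g) = matrixL α β A' ((r : ℂ) • F ((a, c), g) - g) := by
  set E := EuclideanSpace ℂ (Fin n)
  generalize matrixL α β A' = M
  generalize primL n α β = J
  generalize constL n α β = C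
  -- Integrating `f'' = M (r f - g)` twice gives `(1 - r K) f = C a + J (C c) - K g` with `K = J²
  -- M`. The choice of `r` makes `‖r K‖ < 1`.
  set K : L2 n α β →L[ℂ] L2 n α β := J * J * M with hK
  have hK' : ∀ f, K f = J (J (M f)) := fun _ => rfl
  set r : ℝ := (‖K‖ + 1)⁻¹ with hr
  have hr0 : 0 < r := by positivity
  have hlt : ‖(r : ℂ) • K‖ < 1 := by
    rw [norm_smul, Complex.norm_real, Real.norm_of_nonneg hr0.le, hr, inv_mul_eq_div,
      div_lt_one (by positivity)]
    linarith
  obtain ⟨N, hN⟩ := isUnit_one_sub_of_norm_lt_one hlt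
  have hNN : ∀ f, (N : L2 n α β →L[ℂ] L2 n α β) ((↑N⁻¹ : L2 n α β →L[ℂ] L2 n α β) f) = f :=
    fun f => by rw [← mul_apply_eq_comp, Units.mul_inv, one_apply_eq_self]
  have hNK : ∀ f, (N : L2 n α β →L[ℂ] L2 n α β) f = f - (r : ℂ) • K f := fun f => by
    rw [hN]
    rfl
  generalize (↑N⁻¹ : L2 n α β →L[ℂ] L2 n α β) = S at hNN
  simp only [hNK] at hNN
  let pg : (E × E) × L2 n α β →ₗ[ℂ] L2 n α β := LinearMap.snd ℂ (E × E) (L2 n α β)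
  let pa : (E × E) × L2 n α β →ₗ[ℂ] E := LinearMap.fst ℂ E E ∘ₗ LinearMap.fst ℂ (E × E) (L2 n α β)
  let pc : (E × E) × L2 n α β →ₗ[ℂ] E := LinearMap.snd ℂ E E ∘ₗ LinearMap.fst ℂ (E × E) (L2 n α β)
  let F : (E × E) × L2 n α β →ₗ[ℂ] L2 n α β := S.toLinearMap ∘ₗ
    (C.toLinearMap ∘ₗ pa + J.toLinearMap ∘ₗ C.toLinearMap ∘ₗ pc - K.toLinearMap ∘ₗ pg)
  let F₂ : (E × E) × L2 n α β →ₗ[ℂ] L2 n α β := M.toLinearMap ∘ₗ ((r : ℂ) • F - pg)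
  let F₁ : (E × E) × L2 n α β →ₗ[ℂ] L2 n α β := C.toLinearMap ∘ₗ pc + J.toLinearMap ∘ₗ F₂
  have hF : ∀ a c g, F ((a, c), g) = S (C a + J (C c) - K g) := fun _ _ _ => rfl
  have hF₂ : ∀ x, F₂ x = M ((r : ℂ) • F x - x.2) := fun _ => rfl
  have hF₁ : ∀ x, F₁ x = C x.1.2 + J (F₂ x) := fun _ => rfl
  refine ⟨r, hr0, F, F₁, F₂, fun a c g => ⟨?_, hF₁ _, hF₂ _⟩⟩
  have h1 := hNN (C a + J (C c) - K g)
  rw [← hF, sub_eq_iff_eq_add] at h1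
  have h2 : J (J (F₂ ((a, c), g))) = (r : ℂ) • K (F ((a, c), g)) - K g := by
    rw [hF₂, ← hK', map_sub, map_smul]
  rw [hF₁, map_add, h2]
  conv_lhs => rw [h1]
  abel

lemma exists_sub_neg_operatorH_eq (hαβ : α < β) (hA : IsUnit A) (hUV : IsCompl U V)
    (hacc : IsAccretive A)
    (hAVU : V.map (Matrix.toEuclideanCLM (𝕜 := ℂ) A).toLinearMap ⟂ U) :
    ∃ r : ℝ, 0 < r ∧ ∀ g : L2 n α β, ∃ f : (-(operatorH α β A U V)).domain,
      (r : ℂ) • (f : L2 n α β) - (-(operatorH α β A U V)) f = g := by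
  have hdet : IsUnit A.det := (Matrix.isUnit_iff_isUnit_det A).1 hA
  have hMM' : ∀ f, matrixL α β A (matrixL α β A⁻¹ f) = f :=
    matrixL_mul_apply A A⁻¹ (Matrix.mul_nonsing_inv A hdet)
  obtain ⟨r, hr0, F, F₁, F₂, hF⟩ := exists_initialValueProblem_solution α β A⁻¹
  refine ⟨r, hr0, fun g => ?_⟩
  have hsol : ∀ a ∈ U, ∀ c ∈ V, ∀ g, a + integralL n α β (F₁ ((a, c), g)) ∈ U →
      c + integralL n α β (F₂ ((a, c), g)) ∈ V →
      ∃ f : (-(operatorH α β A U V)).domain, (f : L2 n α β) = F ((a, c), g) ∧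
        (r : ℂ) • (f : L2 n α β) - (-(operatorH α β A U V)) f = g := by
    intro a ha c hc g hb hd
    obtain ⟨h0, h1, h2⟩ := hF a c g
    obtain ⟨hmem, h3⟩ := (exists_mem_bvpDomain_secondDeriv_eq_iff (U := U) (V := V) hαβ).2
      ⟨a, ha, c, hc, _, h0, h1, hb, hd⟩
    refine ⟨⟨F ((a, c), g), hmem⟩, rfl, ?_⟩
    rw [neg_operatorH_apply, h3, h2, hMM', sub_sub_cancel]
  obtain ⟨a, ha, c, hc, hb, hd⟩ := exists_linearMap_add_mem hUV
    (LinearMap.fst ℂ _ _ ∘ₗ LinearMap.fst ℂ _ _ + (integralL n α β).toLinearMap ∘ₗ F₁)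
    (LinearMap.snd ℂ _ _ ∘ₗ LinearMap.fst ℂ _ _ + (integralL n α β).toLinearMap ∘ₗ F₂)
    -- Homogeneous uniqueness: for `g = 0` dissipativity gives `r ‖f‖ ≤ 0`, so `f = 0` and its
    -- initial data vanish.
    (fun a ha c hc hb hd => by
      obtain ⟨f, hf, hf0⟩ := hsol a ha c hc 0 hb hd
      have h1 := norm_le_norm_smul_sub (c := r) (re_inner_neg_operatorH_nonpos hαβ hacc hAVU) f
      rw [hf0, norm_zero] at h1
      have h2 : (f : L2 n α β) = 0 := by
        by_contra h
        have := mul_pos hr0 (norm_pos_iff.2 h)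
        linarith
      obtain ⟨h3, h4, -⟩ := hF a c 0
      rw [hf, h3] at h2
      obtain ⟨ha0, h5⟩ := constL_add_primL_eq_zero hαβ h2
      rw [h4] at h5
      exact ⟨ha0, (constL_add_primL_eq_zero hαβ h5).1⟩) g
  obtain ⟨f, -, hf⟩ := hsol a ha c hc g hb hd
  exact ⟨f, hf⟩

end BoundaryValueProblem

end SecondOrderSystem

end

theorem theorem29 (n : ℕ) (α β : ℝ) (hαβ : α < β)
    (A : Matrix (Fin n) (Fin n) ℂ) (hA : IsUnit A)
    (U V : Submodule ℂ (EuclideanSpace ℂ (Fin n))) (hUV : IsCompl U V)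
    (hacc : SecondOrderSystem.IsAccretive A)
    (hAVU : V.map (Matrix.toEuclideanCLM (𝕜 := ℂ) A).toLinearMap ⟂ U) :
    SecondOrderSystem.GeneratesContractionSemigroup
      (-(SecondOrderSystem.operatorH α β A U V)) := by
  obtain ⟨r, hr, hs⟩ :=
    SecondOrderSystem.exists_sub_neg_operatorH_eq hαβ hA hUV hacc hAVU
  exact SecondOrderSystem.generatesContractionSemigroup_of_dissipative
    (SecondOrderSystem.re_inner_neg_operatorH_nonpos hαβ hacc hAVU) hr hs
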